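/- Let $P,X,Y,E$ be finite-dimensional Euclidean spaces (e.g. $P=\mathbb R^m$, $X=\mathbb R^n$, $Y=\mathbb R^l$), $Z:=P\times X$, and let $P^*,X^*,\dots$ be the dual spaces. **Notation.** For $\Omega\subset Z$ and $z\in\Omega$ let $T_\Omega(z)=\{w\mid \exists\, t_k\downarrow0,\ w_k\to w,\ z+t_kw_k\in\Omega\ \forall k\}$ be the contingent cone, $\widehat N_\Omega(z)=\{z^*\mid \limsup_{y\to z,\,y\in\Omega}\langle z^*,y-z\rangle/\|y-z\|\le0\}$ the regular normal cone, $N_\Omega(z)=\{\lim z_k^*\mid z_k^*\in\widehat N_\Omega(z_k),\ z_k\to z,\ z_k\in\Omega\}$ the limiting normal cone ($N_\Omega(z)=\emptyset$ for $z\notin\Omega$), and $\mathcal K_\Omega(z,z^*)=T_\Omega(z)\cap\{w\mid\langle z^*,w\rangle=0\}$ the critical cone. For a set-valued mapping $F$ and $(z,u)\in\operatorname{gph}F$, $DF(z,u)(w):=\{v\mid(w,v)\in T_{\operatorname{gph}F}(z,u)\}$ is the graphical derivative. Let $\pi_{X^*}(p^*,x^*):=x^*$, and let $A^*$ denote the adjoint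 of a linear map $A$. **Setting.** Let $g\colon Z\to Y$, let $C\subset Y$ be closed, $\Gamma(p):=\{x\in X\mid g(p,x)\in C\}$, $\Psi(p,x):=N_{\Gamma(p)}(x)$, $\bar z=(\bar p,\bar x)$ with $g(\bar z)\in C$, and $\bar x^*\in N_{\Gamma(\bar p)}(\bar x)$. Assume: 1. $g$ is $C^2$-smooth around $\bar z$; 2. $C$ is $C^2$-reducible at $\bar y:=g(\bar z)$ to a closed convex cone $K\subset E$: there are a neighborhood $V$ of $\bar y$ and a $C^2$ mapping $h\colon V\to E$ with $h(\bar y)=0$, $\nabla h(\bar y)$ surjective and $C\cap V=\{y\in V\mid h(y)\in K\}$; 3. Robinson stability: there are $\kappa\ge0$ and neighborhoods $W$ of $\bar p$ and $U$ of $\bar x$ with $\operatorname{dist}(x;\Gamma(p))\le\kappa\operatorname{dist}(g(p,x);C)$ for all $(p,x)\in W\times U$ (where $\operatorname{dist}(x;\emptyset)=\infty$); 4. either $\mathcal P=P$ or $K$ is polyhedral, where, with $G:=h\circ g$ and $\operatorname{lin}K:=K\cap(-K)$, $\mathcal P:=\{q\in P\mid\nabla_pG(\bar z)q\in\operatorname{rge}\nabla_xG(\bar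 z)+\operatorname{lin}K\}$. For $z^*\in N_{\operatorname{gph}\Gamma}(\bar z)$ let $\Lambda(\bar z,z^*):=\{\lambda\in N_C(\bar y)\mid\nabla g(\bar z)^*\lambda=z^*\}$. For $\lambda\in N_C(\bar y)$ let $\mu_\lambda:=(\nabla h(\bar y)^*)^{-1}\lambda$ be the unique $\mu\in E^*$ with $\nabla h(\bar y)^*\mu=\lambda$, and let $$\widetilde{\mathcal H}_\lambda v:=\nabla g(\bar z)^*\,\nabla^2\langle\mu_\lambda,h(\cdot)\rangle(\bar y)\,\nabla g(\bar z)v .$$ For $v\in Z$ let $\Lambda(\bar z,z^*;v)$ be the set of maximizers over $\lambda\in\Lambda(\bar z,z^*)$ of $\langle\lambda,\nabla^2g(\bar z)(v,v)\rangle+\nabla^2\langle\mu_\lambda,h(\cdot)\rangle(\bar y)(\nabla g(\bar z)v,\nabla g(\bar z)v)$. **Conclusion.** One has $$T_{\operatorname{gph}\Psi}(\bar p,\bar x,\bar x^*)=\bigcup_{z^*\in N_{\operatorname{gph}\Gamma}(\bar z)\cap\pi_{X^*}^{-1}(\bar x^*)}\big\{(v,\pi_{X^*}(v^*))\ \big|\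 (v,v^*)\in T_{\operatorname{gph}N_{\operatorname{gph}\Gamma}}(\bar z,z^*)\big\},$$ and, for every $v\in Z$, $$D\Psi(\bar p,\bar x,\bar x^*)(v)=\bigcup_{z^*\in N_{T_{\operatorname{gph}\Gamma}(\bar z)}(v)\cap\pi_{X^*}^{-1}(\bar x^*)}\pi_{X^*}\big(DN_{\operatorname{gph}\Gamma}(\bar z,z^*)(v)\big).$$ Moreover, for every $z^*\in N_{\operatorname{gph}\Gamma}(\bar z)$, $$T_{\operatorname{gph}N_{\operatorname{gph}\Gamma}}(\bar z,z^*)=\Big\{(v,v^*)\ \Big|\ \exists\,\hat\lambda\in\Lambda(\bar z,z^*;v):\ v^*\in\big(\nabla^2\langle\hat\lambda,g\rangle(\bar z)+\widetilde{\mathcal H}_{\hat\lambda}\big)v+N_{\mathcal K_{\operatorname{gph}\Gamma}(\bar z,z^*)}(v)\Big\},$$ and, for every $v\in Z$, $$DN_{\operatorname{gph}\Gamma}(\bar z,z^*)(v)=\bigcup_{\hat\lambda\in\Lambda(\bar z,z^*;v)}\Big(\big(\nabla^2\langle\hat\lambda,g\rangle(\bar z)+\widetilde{\mathcal H}_{\hat\lambda}\big)v+N_{\mathcal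 K_{\operatorname{gph}\Gamma}(\bar z,z^*)}(v)\Big).$$ -/

import Mathlib

open Set Filter Topology
open scoped NNReal ENNReal

noncomputable section

namespace VarAnalysis

/-! ### Variational analysis: graphs, tangent cones, normal cones, graphical derivatives

Dual spaces are `StrongDual ℝ _` and are not identified with the primal spaces.  All spaces will be
finite-dimensional; products carry Mathlib's maximum norm, which is equivalent to the Euclidean one
and so gives the same tangent and normal cones. -/

/-- The graph of a set-valued mapping. -/
def gph {A B : Type*} (F : A → Set B) : Set (A × B) :=
  {w | w.2 ∈ F w.1}

section Normed

variable {Z : Type*} [NormedAddCommGroup Z] [NormedSpace ℝ Z]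
variable {U : Type*} [NormedAddCommGroup U] [NormedSpace ℝ U]

/-- The (Bouligand-Severi) tangent, or contingent, cone to `Ω` at `z`. -/
def tangentCone (Ω : Set Z) (z : Z) : Set Z :=
  {w | ∃ (t : ℕ → ℝ) (d : ℕ → Z), (∀ k, 0 < t k) ∧ Tendsto t atTop (𝓝 0) ∧
    Tendsto d atTop (𝓝 w) ∧ ∀ k, z + t k • d k ∈ Ω}

/-- The (Fréchet) regular normal cone to `Ω` at `z`: the functionals `zs` with
`limsup ⟨zs, y - z⟩ / ‖y - z‖ ≤ 0` as `y → z` in `Ω`.  It is empty when `z ∉ Ω`. -/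
def regularNormalCone (Ω : Set Z) (z : Z) : Set (StrongDual ℝ Z) :=
  {zs | z ∈ Ω ∧ ∀ ε : ℝ, 0 < ε → ∀ᶠ y in 𝓝[Ω] z, zs (y - z) ≤ ε * ‖y - z‖}

/-- The (Mordukhovich) limiting normal cone to `Ω` at `z`.  It is empty when `z ∉ Ω`. -/
def normalCone (Ω : Set Z) (z : Z) : Set (StrongDual ℝ Z) :=
  {zs | z ∈ Ω ∧ ∃ (y : ℕ → Z) (ys : ℕ → StrongDual ℝ Z), Tendsto y atTop (𝓝 z) ∧
    Tendsto ys atTop (𝓝 zs) ∧ ∀ k, ys k ∈ regularNormalCone Ω (y k)}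

/-- The critical cone `T_Ω(z) ∩ {zs}^⊥`. -/
def criticalCone (Ω : Set Z) (z : Z) (zs : StrongDual ℝ Z) : Set Z :=
  tangentCone Ω z ∩ {w | zs w = 0}

/-- The graphical derivative of the set-valued mapping `F` at the point `(z, u)` of its graph. -/
def graphicalDeriv (F : Z → Set U) (z : Z) (u : U) (w : Z) : Set U :=
  {v | (w, v) ∈ tangentCone (gph F) (z, u)}

/-- The adjoint `A^* : F^* → D^*` of a continuous linear map `A : D → F`, `A^* μ = μ ∘ A`. -/
def adj {D F : Type*} [NormedAddCommGroup D] [NormedSpace ℝ D] [NormedAddCommGroup F]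
    [NormedSpace ℝ F] (A : D →L[ℝ] F) (μ : StrongDual ℝ F) : StrongDual ℝ D :=
  μ.comp A

/-- The second derivative `∇²f(z)`, as a bilinear map: `hess f z v w = ∇²f(z)(v, w)`. -/
def hess {D F : Type*} [NormedAddCommGroup D] [NormedSpace ℝ D] [NormedAddCommGroup F]
    [NormedSpace ℝ F] (f : D → F) (z : D) : D →L[ℝ] D →L[ℝ] F :=
  fderiv ℝ (fderiv ℝ f) z

/-- A polyhedral set: the solution set of finitely many linear inequalities. -/
def IsPolyhedral (A : Set Z) : Prop :=
  ∃ s : Finset (StrongDual ℝ Z × ℝ), A = {y | ∀ p ∈ s, p.1 y ≤ p.2}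

/-- The closed set `C` is reduced at `y₀ ∈ C` to the closed convex cone `K` by the mapping `h`, which
is twice continuously differentiable on a neighbourhood `V` of `y₀`. -/
def IsC2Reduction {Y E : Type*} [NormedAddCommGroup Y] [NormedSpace ℝ Y] [NormedAddCommGroup E]
    [NormedSpace ℝ E] (C : Set Y) (K : ProperCone ℝ E) (h : Y → E) (y₀ : Y) : Prop :=
  IsClosed C ∧ y₀ ∈ C ∧ h y₀ = 0 ∧ Function.Surjective (fderiv ℝ h y₀) ∧
    ∃ V : Set Y, IsOpen V ∧ y₀ ∈ V ∧ ContDiffOn ℝ 2 h V ∧ C ∩ V = {y | y ∈ V ∧ h y ∈ K}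

end Normed

/-! ### Parametric constraint systems `g(p, x) ∈ C` -/

section PCS

variable {P X Y E : Type*} [NormedAddCommGroup P] [NormedSpace ℝ P]
  [NormedAddCommGroup X] [NormedSpace ℝ X] [NormedAddCommGroup Y] [NormedSpace ℝ Y]
  [NormedAddCommGroup E] [NormedSpace ℝ E]

/-- The solution map `Γ(p) = {x | g(p, x) ∈ C}`. -/
def Gam (g : P × X → Y) (C : Set Y) (p : P) : Set X :=
  {x | g (p, x) ∈ C}

/-- The normal cone mapping `Ψ(p, x) = N_{Γ(p)}(x)`, with empty values when `x ∉ Γ(p)`. -/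
def Psi (g : P × X → Y) (C : Set Y) (z : P × X) : Set (StrongDual ℝ X) :=
  normalCone (Gam g C z.1) z.2

/-- Robinson stability at `z = (p, x)`.  Distances are extended-valued, so that the distance to the
empty set is `∞`. -/
def RobinsonStable (g : P × X → Y) (C : Set Y) (z : P × X) : Prop :=
  ∃ κ : ℝ≥0, ∃ W ∈ 𝓝 z.1, ∃ U ∈ 𝓝 z.2, ∀ p ∈ W, ∀ x ∈ U,
    Metric.infEDist x (Gam g C p) ≤ (κ : ℝ≥0∞) * Metric.infEDist (g (p, x)) C

/-- The projection `π_{X^*} : P^* × X^* → X^*`, where `P^* × X^*` is the dual of `P × X`; it sends a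
functional on `P × X` to its restriction to `{0} × X`. -/
def projX (zs : StrongDual ℝ (P × X)) : StrongDual ℝ X :=
  zs.comp (ContinuousLinearMap.inr ℝ P X)

/-- The partial derivative `∇_p f(z)`. -/
def partialP (f : P × X → E) (z : P × X) : P →L[ℝ] E :=
  (fderiv ℝ f z).comp (ContinuousLinearMap.inl ℝ P X)

/-- The partial derivative `∇_x f(z)`. -/
def partialX (f : P × X → E) (z : P × X) : X →L[ℝ] E :=
  (fderiv ℝ f z).comp (ContinuousLinearMap.inr ℝ P X)

/-- The characteristic subspace `𝒫 = {q | ∇_p G(z) q ∈ rge ∇_x G(z) + lin K}` of the parameter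
space, where `G = h ∘ g`. -/
def charSubspace (g : P × X → Y) (h : Y → E) (K : ProperCone ℝ E) (z : P × X) : Set P :=
  {q | ∃ u : X, ∃ e ∈ PointedCone.lineal (K : PointedCone ℝ E),
    partialP (h ∘ g) z q = partialX (h ∘ g) z u + e}

/-- `(∇h(y)^*)⁻¹ λ`: the functional `μ` with `∇h(y)^* μ = λ`.  When `∇h(y)` is surjective there is
at most one such `μ`, see `pullback_adj`. -/
def pullback (h : Y → E) (y : Y) (lam : StrongDual ℝ Y) : StrongDual ℝ E :=
  Function.invFun (adj (fderiv ℝ h y)) lam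

theorem pullback_adj (h : Y → E) (y : Y) (hs : Function.Surjective (fderiv ℝ h y))
    (μ : StrongDual ℝ E) : pullback h y (adj (fderiv ℝ h y) μ) = μ := by
  refine Function.leftInverse_invFun (fun a b hab => ?_) μ
  ext e
  obtain ⟨d, rfl⟩ := hs e
  exact DFunLike.congr_fun hab d

/-- `∇²⟨(∇h(y)^*)⁻¹ λ, h(·)⟩(y)`. -/
def curvature (h : Y → E) (y : Y) (lam : StrongDual ℝ Y) : Y →L[ℝ] Y →L[ℝ] ℝ :=
  hess (fun y' => pullback h y lam (h y')) y

variable {Z : Type*} [NormedAddCommGroup Z] [NormedSpace ℝ Z]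

/-- The multiplier set `Λ(z, zs) = {λ ∈ N_C(g(z)) | ∇g(z)^* λ = zs}`. -/
def multipliers (g : Z → Y) (C : Set Y) (z : Z) (zs : StrongDual ℝ Z) : Set (StrongDual ℝ Y) :=
  {lam | lam ∈ normalCone C (g z) ∧ adj (fderiv ℝ g z) lam = zs}

/-- The directional multiplier set `Λ(z, zs; v)`: the maximizers over `λ ∈ Λ(z, zs)` of
`⟨λ, ∇²g(z)(v, v)⟩ + ∇²⟨(∇h(g(z))^*)⁻¹ λ, h(·)⟩(g(z)) (∇g(z)v, ∇g(z)v)`. -/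
def dirMultipliers (g : Z → Y) (C : Set Y) (h : Y → E) (z : Z) (zs : StrongDual ℝ Z) (v : Z) :
    Set (StrongDual ℝ Y) :=
  {lam | lam ∈ multipliers g C z zs ∧
    IsMaxOn (fun l : StrongDual ℝ Y => l (hess g z v v) +
      curvature h (g z) l (fderiv ℝ g z v) (fderiv ℝ g z v)) (multipliers g C z zs) lam}

/-- `H̃_λ v = ∇g(z)^* ∇²⟨(∇h(g(z))^*)⁻¹ λ, h(·)⟩(g(z)) ∇g(z) v`. -/
def curvTerm (g : Z → Y) (h : Y → E) (z : Z) (lam : StrongDual ℝ Y) (v : Z) : StrongDual ℝ Z :=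
  adj (fderiv ℝ g z) (curvature h (g z) lam (fderiv ℝ g z v))

end PCS

end VarAnalysis

end

/-! Put `G = h ∘ g`. Near the reference point `gph Γ` is the set `G z ∈ K`, with `G` vanishing at
the point itself. Robinson stability becomes an estimate of the distance from `x` to `Γ(p)` by
`κ‖G(p,x) - k‖`, uniform over small `k ∈ K`. Convex duality in penalty form
(`exists_multiplier_of_penalty`) then gives every normal at a nearby point, to `gph Γ` or to `Γ(p)`,
a multiplier in the polar of `K` bounded by `κ` times the norm of the normal. Multipliers along
sequences therefore have convergent subsequences.

Tangents `(v, v*)` to the graph of the normal cone mapping of `gph Γ` are exactly the pairs with `v*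
= μ ∘ ∇²G(z₀)v + ω`, where `(v, μ, ω)` solves `SecondOrderSystem`. Necessity: for multipliers `m_j →
μ` along a tangent sequence, the quotients of the normals split into a Hessian part and `(m_j - μ) ∘
∇G(z₀) / t_j → ω`; complementarity and a second-order expansion give the system
(`critical_of_tendsto_multipliers`). Sufficiency: minimize `-(ζ + t v*)` plus a strong quadratic
penalty centred at `z₀ + t v` over a compact piece of `gph Γ`. The minimizers carry regular normals,
and comparison with the nearly optimal arcs supplied by duality forces them to be `z₀ + t(v + o(1))`
(`ReducedSystem.mem_tangentCone_gph`).

For `Ψ`, a multiplier of a normal to `gph Γ` also represents the projected normal to `Γ(p)`, which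
yields one inclusion. For the other, only the `X`-part of the multiplier quotients is known to
converge. If the characteristic subspace is everything, the full quotients converge
(`exists_tendsto_of_charSubspace`). If `K` is polyhedral, closedness of finitely generated cones
lifts the limit of the projections to an admissible `ω` (`exists_secondOrderSystem_of_polyhedral`).
Finally `λ = ∇h(ȳ)^*μ` translates multipliers for `K` into multipliers for `C`. -/

namespace VarAnalysis

/-! ### Finitely generated cones, Farkas' lemma and a multiplier rule. -/

section Cones

/-- Conic Carathéodory theorem: a nonnegative combination of a finite family of vectors is a
nonnegative combination of a linearly independent subfamily. -/
theorem exists_linearIndepOn_nonneg_combination {ι E : Type*} [AddCommGroup E] [Module ℝ E]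
    (a : ι → E) (t : Finset ι) (c : ι → ℝ) (hc : ∀ i, 0 ≤ c i) :
    ∃ t' ⊆ t, LinearIndepOn ℝ a (t' : Set ι) ∧ ∃ c' : ι → ℝ, (∀ i, 0 ≤ c' i) ∧
      ∑ i ∈ t', c' i • a i = ∑ i ∈ t, c i • a i := by
  classical
  induction t using Finset.strongInduction generalizing c with
  | H t ih =>
    by_cases hli : LinearIndepOn ℝ a (t : Set ι)
    · exact ⟨t, subset_rfl, hli, c, hc, rfl⟩
    rw [linearIndepOn_finset_iff] at hli
    push Not at hli
    obtain ⟨d₀, hd₀, j₀, hj₀t, hj₀⟩ := hli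
    obtain ⟨d, hd, j, hjt, hj⟩ : ∃ d : ι → ℝ, ∑ i ∈ t, d i • a i = 0 ∧ ∃ j ∈ t, 0 < d j := by
      rcases lt_or_gt_of_ne hj₀ with h | h
      · exact ⟨fun i => -d₀ i, by simp [hd₀], j₀, hj₀t, by simpa using h⟩
      · exact ⟨d₀, hd₀, j₀, hj₀t, h⟩
    -- Ratio test: the least `c i / d i` over positive `d i` is the largest multiple of the relation
    -- that can be subtracted while all coefficients stay nonnegative, and it annihilates the
    -- coefficient of `i`.
    obtain ⟨i, hi, hmin⟩ := Finset.exists_min_image (t.filter fun i => 0 < d i)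
      (fun i => c i / d i) ⟨j, by simp [hjt, hj]⟩
    simp only [Finset.mem_filter] at hi hmin
    set θ := c i / d i with hθ
    have hθ0 : 0 ≤ θ := div_nonneg (hc i) hi.2.le
    let c₁ : ι → ℝ := fun l => if l ∈ t then c l - θ * d l else 0
    have hc₁ : ∀ l, 0 ≤ c₁ l := by
      intro l
      by_cases hl : l ∈ t
      · simp only [c₁, hl, if_true]
        rcases lt_or_ge 0 (d l) with h | h
        · have := hmin l ⟨hl, h⟩
          rw [le_div_iff₀ h] at this
          linarith
        · nlinarith [hc l, mul_nonneg hθ0 (neg_nonneg.2 h)]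
      · simp [c₁, hl]
    have hsum : ∑ l ∈ t.erase i, c₁ l • a l = ∑ l ∈ t, c l • a l := by
      have h0 : c₁ i = 0 := by
        have := hi.2.ne'
        simp only [c₁, hi.1, if_true, hθ]
        field_simp
        ring
      have h1 : ∑ l ∈ t, c₁ l • a l = ∑ l ∈ t.erase i, c₁ l • a l := by
        rw [← Finset.add_sum_erase t _ hi.1, h0]
        simp
      rw [← h1]
      calc ∑ l ∈ t, c₁ l • a l = ∑ l ∈ t, (c l • a l - θ • (d l • a l)) := by
            refine Finset.sum_congr rfl fun l hl => ?_
            simp only [c₁, hl, if_true, sub_smul, mul_smul]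
        _ = _ := by rw [Finset.sum_sub_distrib, ← Finset.smul_sum, hd]; simp
    obtain ⟨t', ht', hli', c', hc', hs'⟩ := ih _ (Finset.erase_ssubset hi.1) c₁ hc₁
    exact ⟨t', ht'.trans (Finset.erase_subset _ _), hli', c', hc', hs'.trans hsum⟩

/-- Finitely generated cones are closed. -/
theorem isClosed_nonneg_combinations {ι E : Type*} [Fintype ι] [NormedAddCommGroup E]
    [NormedSpace ℝ E] (a : ι → E) :
    IsClosed {x : E | ∃ c : ι → ℝ, (∀ i, 0 ≤ c i) ∧ ∑ i, c i • a i = x} := by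
  classical
  -- By Carathéodory the cone is a finite union of images of closed orthants under injective linear
  -- maps, which are closed embeddings in finite dimension.
  have key : {x : E | ∃ c : ι → ℝ, (∀ i, 0 ≤ c i) ∧ ∑ i, c i • a i = x} =
      ⋃ t ∈ {t : Finset ι | LinearIndepOn ℝ a (t : Set ι)},
        (Fintype.linearCombination ℝ (fun i : t => a i)) '' {c | ∀ i, 0 ≤ c i} := by
    ext x
    simp only [mem_ofPred_eq, mem_iUnion, mem_image, exists_prop]
    constructor
    · rintro ⟨c, hc, rfl⟩
      obtain ⟨t, -, hli, c', hc', hs⟩ :=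
        exists_linearIndepOn_nonneg_combination a Finset.univ c hc
      refine ⟨t, hli, fun i => c' i, fun i => hc' i, ?_⟩
      rw [Fintype.linearCombination_apply, ← hs, ← Finset.sum_coe_sort t]
    · rintro ⟨t, -, c, hc, rfl⟩
      refine ⟨fun i => if h : i ∈ t then c ⟨i, h⟩ else 0, fun i => ?_, ?_⟩
      · by_cases h : i ∈ t
        · simpa [h] using hc ⟨i, h⟩
        · simp [h]
      · rw [Fintype.linearCombination_apply, ← Finset.sum_subset (Finset.subset_univ t),
          ← Finset.sum_coe_sort t]
        · simp
        · intro i _ h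
          simp [h]
  rw [key]
  refine (Set.toFinite _).isClosed_biUnion fun t ht => ?_
  have hinj : Function.Injective (Fintype.linearCombination ℝ (fun i : t => a i)) :=
    LinearIndependent.fintypeLinearCombination_injective ht
  refine (LinearMap.isClosedEmbedding_of_injective (LinearMap.ker_eq_bot.2 hinj)).isClosedMap _ ?_
  have : {c : t → ℝ | ∀ i, 0 ≤ c i} = ⋂ i, {c | 0 ≤ c i} := by ext; simp
  rw [this]
  exact isClosed_iInter fun i => isClosed_le continuous_const (continuous_apply i)

/-- Farkas' lemma. -/
theorem exists_nonneg_combination_of_polar {ι E : Type*} [Fintype ι] [NormedAddCommGroup E]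
    [NormedSpace ℝ E] [FiniteDimensional ℝ E] (a : ι → StrongDual ℝ E) (μ : StrongDual ℝ E)
    (hμ : ∀ e, (∀ i, a i e ≤ 0) → μ e ≤ 0) :
    ∃ c : ι → ℝ, (∀ i, 0 ≤ c i) ∧ ∑ i, c i • a i = μ := by
  classical
  by_contra hcon
  have hconv : Convex ℝ {x : StrongDual ℝ E | ∃ c : ι → ℝ, (∀ i, 0 ≤ c i) ∧
      ∑ i, c i • a i = x} := by
    rintro _ ⟨c, hc, rfl⟩ _ ⟨d, hd, rfl⟩ p q hp hq -
    refine ⟨fun i => p * c i + q * d i, fun i => add_nonneg (mul_nonneg hp (hc i))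
      (mul_nonneg hq (hd i)), ?_⟩
    simp only [add_smul, mul_smul, Finset.sum_add_distrib, Finset.smul_sum]
  obtain ⟨f, u, hu, hf⟩ := geometric_hahn_banach_point_closed hconv
    (isClosed_nonneg_combinations a) hcon
  -- By reflexivity the separating functional is evaluation at some `e`; the point `-e` will
  -- contradict `hμ`.
  obtain ⟨e, he⟩ := (Module.evalEquiv ℝ E).surjective
    ((f : StrongDual ℝ E →ₗ[ℝ] ℝ) ∘ₗ (LinearMap.toContinuousLinearMap (𝕜 := ℝ) (E := E)
      (F' := ℝ)).toLinearMap)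
  have hfe : ∀ ν : StrongDual ℝ E, f ν = ν e := by
    intro ν
    have := LinearMap.congr_fun he (ν : E →ₗ[ℝ] ℝ)
    simp at this
    rw [this]
    rfl
  have hu0 : u < 0 := by simpa using hf 0 ⟨0, by simp, by simp⟩
  have h1 : ∀ i, a i (-e) ≤ 0 := by
    intro i
    by_contra! h
    rw [map_neg] at h
    have h2 := hf ((u / (a i e)) • a i) ⟨Pi.single i (u / (a i e)), fun l => ?_, ?_⟩
    · rw [hfe] at h2
      simp [show a i e ≠ 0 by linarith] at h2
    · by_cases hl : l = i
      · subst hl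
        simpa using (div_pos_of_neg_of_neg hu0 (by linarith)).le
      · simp [hl]
    · simp [Pi.single_apply]
  have h2 := hμ _ h1
  rw [hfe] at hu
  rw [map_neg] at h2
  linarith

theorem eq_zero_of_forall_mul_le {a c : ℝ} (h : ∀ t : ℝ, t * a ≤ c) : a = 0 := by
  by_contra ha
  have := h ((c + 1) / a)
  rw [div_mul_cancel₀ _ ha] at this
  linarith

theorem nonpos_of_forall_mul_le {a c : ℝ} (h : ∀ t : ℝ, 0 ≤ t → t * a ≤ c) : a ≤ 0 := by
  by_contra! ha
  have := h ((|c| + 1) / a) (by positivity)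
  rw [div_mul_cancel₀ _ ha.ne'] at this
  linarith [le_abs_self c]

/-- A multiplier rule: an exact penalty estimate for a conic linear problem yields a multiplier. -/
theorem exists_multiplier_of_penalty {Z E : Type*} [NormedAddCommGroup Z] [NormedSpace ℝ Z]
    [NormedAddCommGroup E] [NormedSpace ℝ E] (K : ProperCone ℝ E) (B : Z →L[ℝ] E) (b y : E)
    (ζ : StrongDual ℝ Z) (s L : ℝ) (hL : 0 ≤ L)
    (h : ∀ u : Z, ∀ k ∈ K, ∀ σ : ℝ, 0 ≤ σ → ζ u - s ≤ L * ‖B u + b - (k - σ • y)‖) :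
    ∃ μ : StrongDual ℝ E, ‖μ‖ ≤ L ∧ μ.comp B = ζ ∧ (∀ k ∈ K, μ k ≤ 0) ∧ 0 ≤ μ y ∧ -μ b ≤ s := by
  have hK : ∀ k ∈ K, ∀ p : ℝ, 0 ≤ p → p • k ∈ K := fun k hk p hp => K.smul_mem hk hp
  -- The open cone `r < -L‖e‖` is separated from the pairs formed by a residual `B u + b - (k - σ
  -- y)` and a number `r ≥ s - ζ u`. The penalty estimate is their disjointness.
  have hs_conv : Convex ℝ {w : E × ℝ | w.2 + L * ‖w.1‖ < 0} := by
    intro w hw w' hw' p q hp hq hpq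
    simp only [mem_ofPred_eq, Prod.fst_add, Prod.snd_add, Prod.smul_fst, Prod.smul_snd,
      smul_eq_mul] at hw hw' ⊢
    have h1 : ‖p • w.1 + q • w'.1‖ ≤ p * ‖w.1‖ + q * ‖w'.1‖ := by
      refine (norm_add_le _ _).trans ?_
      rw [norm_smul, norm_smul, Real.norm_of_nonneg hp, Real.norm_of_nonneg hq]
    have h2 := mul_le_mul_of_nonneg_left h1 hL
    rcases hp.eq_or_lt with rfl | hp'
    · have : q = 1 := by linarith
      subst this
      linarith
    · nlinarith [mul_pos_of_neg_of_neg hw (neg_neg_of_pos hp'),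
        mul_nonneg hq (neg_nonneg.2 hw'.le)]
  have hs_open : IsOpen {w : E × ℝ | w.2 + L * ‖w.1‖ < 0} :=
    isOpen_lt (by fun_prop) continuous_const
  have ht_conv : Convex ℝ {w : E × ℝ | ∃ u : Z, ∃ k ∈ K, ∃ σ : ℝ, 0 ≤ σ ∧
      w.1 = B u + b - (k - σ • y) ∧ s - ζ u ≤ w.2} := by
    rintro w ⟨u, k, hk, σ, hσ, hw1, hw2⟩ w' ⟨u', k', hk', σ', hσ', hw1', hw2'⟩ p q hp hq hpq
    refine ⟨p • u + q • u', p • k + q • k', K.add_mem (hK _ hk _ hp) (hK _ hk' _ hq),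
      p * σ + q * σ', by positivity, ?_, ?_⟩
    · have hb : b = p • b + q • b := by rw [← add_smul, hpq, one_smul]
      simp only [Prod.fst_add, Prod.smul_fst, hw1, hw1', map_add, map_smul]
      nth_rw 3 [hb]
      module
    · simp only [Prod.snd_add, Prod.smul_snd, smul_eq_mul, map_add, map_smul]
      have hs : s = p * s + q * s := by rw [← add_mul, hpq, one_mul]
      nlinarith [mul_le_mul_of_nonneg_left hw2 hp, mul_le_mul_of_nonneg_left hw2' hq]
  have hdisj : Disjoint {w : E × ℝ | w.2 + L * ‖w.1‖ < 0} {w : E × ℝ | ∃ u : Z, ∃ k ∈ K,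
      ∃ σ : ℝ, 0 ≤ σ ∧ w.1 = B u + b - (k - σ • y) ∧ s - ζ u ≤ w.2} := by
    rw [Set.disjoint_left]
    rintro w hw ⟨u, k, hk, σ, hσ, hw1, hw2⟩
    have := h u k hk σ hσ
    rw [mem_ofPred_eq, hw1] at hw
    linarith
  obtain ⟨f, u₀, hf1, hf2⟩ := geometric_hahn_banach_open hs_conv hs_open ht_conv hdisj
  set ν : StrongDual ℝ E := f.comp (ContinuousLinearMap.inl ℝ E ℝ) with hν
  set c : ℝ := f (0, 1) with hc
  have hf : ∀ (e : E) (r : ℝ), f (e, r) = ν e + r * c := by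
    intro e r
    have : ((e, r) : E × ℝ) = (e, 0) + r • (0, 1) := by simp
    rw [this, map_add, map_smul]
    simp [hν, hc]
  have hb1 : ∀ (e : E) (r : ℝ), r + L * ‖e‖ < 0 → ν e + r * c < u₀ := fun e r her => by
    rw [← hf]; exact hf1 _ her
  have hb2 : ∀ (u : Z), ∀ k ∈ K, ∀ σ : ℝ, 0 ≤ σ → ∀ r, s - ζ u ≤ r →
      u₀ ≤ ν (B u + b - (k - σ • y)) + r * c := fun u k hk σ hσ r hr => by
    rw [← hf]; exact hf2 _ ⟨u, k, hk, σ, hσ, rfl, hr⟩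
  have hu₀ : 0 ≤ u₀ := by
    have : ∀ t : ℝ, 0 < t → -t * c < u₀ := fun t ht => by
      simpa using hb1 0 (-t) (by simpa using ht)
    by_contra! hneg
    rcases le_or_gt c 0 with h0 | h0
    · have := this 1 one_pos
      nlinarith
    · have := this (-u₀ / c) (by apply div_pos <;> linarith)
      rw [← neg_div, div_mul_cancel₀ _ h0.ne'] at this
      linarith
  have hc0 : 0 ≤ c := by
    have : -c ≤ 0 := by
      refine nonpos_of_forall_mul_le (c := u₀ + c) fun t ht => ?_
      have := hb1 0 (-(t + 1)) (by simp; linarith)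
      simp at this
      linarith
    linarith
  -- The separating hyperplane is not vertical: if `c = 0`, then `ν` is bounded above on `E`, hence
  -- zero, and strict separation fails. The multiplier is `ν / c`.
  have hcpos : 0 < c := by
    refine hc0.lt_of_ne fun h0 => ?_
    have hν0 : ∀ e, ν e = 0 := fun e => by
      refine eq_zero_of_forall_mul_le (c := u₀) fun t => ?_
      have := hb1 (t • e) (-(L * ‖t • e‖ + 1)) (by linarith)
      rw [← h0, map_smul, smul_eq_mul] at this
      linarith
    have h1 := hb1 0 (-1) (by simp)
    have h2 := hb2 0 0 K.zero_mem 0 le_rfl (s - ζ 0) le_rfl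
    rw [hν0] at h1 h2
    rw [← h0] at h1 h2
    linarith
  have hνL : ∀ e, ν e ≤ c * L * ‖e‖ := by
    intro e
    have : ν e - c * L * ‖e‖ ≤ 0 := by
      refine nonpos_of_forall_mul_le (c := u₀ + c) fun t ht => ?_
      have := hb1 (t • e) (-(L * ‖t • e‖ + 1)) (by linarith)
      rw [map_smul, smul_eq_mul, norm_smul, Real.norm_of_nonneg ht] at this
      nlinarith
    linarith
  have hmain : ∀ (u : Z), ∀ k ∈ K, ∀ σ : ℝ, 0 ≤ σ →
      0 ≤ ν (B u) + ν b - ν k + σ * ν y + (s - ζ u) * c := fun u k hk σ hσ => by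
    have := hb2 u k hk σ hσ _ le_rfl
    simp only [map_add, map_sub, map_smul, smul_eq_mul] at this
    linarith
  have hz : ∀ u, ν (B u) = c * ζ u := fun u => by
    have : -(ν (B u) - c * ζ u) = 0 := by
      refine eq_zero_of_forall_mul_le (c := ν b + s * c) fun t => ?_
      have := hmain (t • u) 0 K.zero_mem 0 le_rfl
      simp only [map_smul, smul_eq_mul, map_zero] at this
      linarith
    linarith
  refine ⟨c⁻¹ • ν, ?_, ?_, ?_, ?_, ?_⟩
  · refine ContinuousLinearMap.opNorm_le_bound _ hL fun e => ?_
    have h1 := hνL e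
    have h2 := hνL (-e)
    rw [norm_neg, map_neg] at h2
    rw [_root_.smul_apply, norm_smul, norm_inv, Real.norm_of_nonneg hc0,
      inv_mul_le_iff₀ hcpos, Real.norm_eq_abs, abs_le]
    constructor <;> linarith
  · ext u
    simp [hz u, hcpos.ne']
  · intro k hk
    have : ν k ≤ 0 := by
      refine nonpos_of_forall_mul_le (c := ν b + s * c) fun t ht => ?_
      have := hmain 0 (t • k) (hK k hk t ht) 0 le_rfl
      simp only [map_smul, smul_eq_mul, map_zero] at this
      linarith
    simpa using mul_nonpos_of_nonneg_of_nonpos (inv_nonneg.2 hc0) this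
  · have : -ν y ≤ 0 := by
      refine nonpos_of_forall_mul_le (c := ν b + s * c) fun t ht => ?_
      have := hmain 0 0 K.zero_mem t ht
      simp only [map_zero] at this
      linarith
    simpa using mul_nonneg (inv_nonneg.2 hc0) (by linarith : 0 ≤ ν y)
  · have := hmain 0 0 K.zero_mem 0 le_rfl
    simp only [map_zero] at this
    rw [_root_.smul_apply, smul_eq_mul, ← mul_neg, inv_mul_le_iff₀ hcpos]
    linarith

end Cones

/-! ### Tangent and normal cones under metric subregularity. -/

section Normals

variable {Z E : Type*} [NormedAddCommGroup Z] [NormedSpace ℝ Z] [NormedAddCommGroup E]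
  [NormedSpace ℝ E]

theorem mem_tangentCone_iff {Ω : Set Z} {z w : Z} : w ∈ tangentCone Ω z ↔
    ∀ ε : ℝ, 0 < ε → ∃ t : ℝ, 0 < t ∧ t < ε ∧ ∃ d : Z, ‖d - w‖ < ε ∧ z + t • d ∈ Ω := by
  constructor
  · rintro ⟨t, d, ht, ht0, hd, hΩ⟩ ε hε
    have h1 : ∀ᶠ k in atTop, t k < ε := ht0.eventually_lt_const hε
    have h2 : ∀ᶠ k in atTop, ‖d k - w‖ < ε := by
      simpa [dist_eq_norm] using (Metric.tendsto_nhds.1 hd) ε hε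
    obtain ⟨k, hk1, hk2⟩ := (h1.and h2).exists
    exact ⟨t k, ht k, hk1, d k, hk2, hΩ k⟩
  · intro h
    choose t ht htε d hd hΩ using fun k : ℕ => h (1 / ((k : ℝ) + 1)) (by positivity)
    refine ⟨t, d, ht, ?_, ?_, hΩ⟩
    · exact squeeze_zero (fun k => (ht k).le) (fun k => (htε k).le)
        tendsto_one_div_add_atTop_nhds_zero_nat
    · rw [tendsto_iff_norm_sub_tendsto_zero]
      exact squeeze_zero (fun k => norm_nonneg _) (fun k => (hd k).le)
        tendsto_one_div_add_atTop_nhds_zero_nat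

theorem regularNormalCone_subset_normalCone (Ω : Set Z) (z : Z) :
    regularNormalCone Ω z ⊆ normalCone Ω z := fun ζ hζ =>
  ⟨hζ.1, fun _ => z, fun _ => ζ, tendsto_const_nhds, tendsto_const_nhds, fun _ => hζ⟩

theorem mem_regularNormalCone_of_quadratic_bound {Ω : Set Z} {z : Z} {ζ : StrongDual ℝ Z} {c : ℝ}
    (hz : z ∈ Ω) (h : ∀ᶠ y in 𝓝[Ω] z, ζ (y - z) ≤ c * ‖y - z‖ ^ 2) :
    ζ ∈ regularNormalCone Ω z := by
  refine ⟨hz, fun ε hε => ?_⟩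
  have h1 : Tendsto (fun y => c * ‖y - z‖) (𝓝[Ω] z) (𝓝 0) := by
    have : Tendsto (fun y => c * ‖y - z‖) (𝓝 z) (𝓝 (c * ‖z - z‖)) :=
      Continuous.tendsto (by fun_prop) z
    simpa using this.mono_left nhdsWithin_le_nhds
  filter_upwards [h, h1.eventually_lt_const hε] with y hy hy'
  nlinarith [norm_nonneg (y - z)]

/-- Pull-backs of polar functionals are regular normals. -/
theorem comp_mem_regularNormalCone {f : Z → E} {f' : Z →L[ℝ] E} {S : Set Z} {z₀ : Z}
    {K : ProperCone ℝ E} {μ : StrongDual ℝ E} (hf : HasFDerivAt f f' z₀) (hz₀ : z₀ ∈ S)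
    (hS : ∀ᶠ z in 𝓝[S] z₀, f z ∈ K) (hμ : ∀ k ∈ K, μ k ≤ 0) (hμ0 : μ (f z₀) = 0) :
    μ.comp f' ∈ regularNormalCone S z₀ := by
  refine ⟨hz₀, fun ε hε => ?_⟩
  have h1 := hf.isLittleO.def (c := ε / (‖μ‖ + 1)) (by positivity)
  filter_upwards [hS, h1.filter_mono nhdsWithin_le_nhds] with y hy hy'
  have h2 : μ.comp f' (y - z₀) = μ (f y) - μ (f z₀) - μ (f y - f z₀ - f' (y - z₀)) := by
    simp
  rw [h2, hμ0]
  have h3 : -μ (f y - f z₀ - f' (y - z₀)) ≤ ‖μ‖ * ‖f y - f z₀ - f' (y - z₀)‖ :=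
    (neg_le_abs _).trans (μ.le_opNorm _)
  have h4 : ‖μ‖ * ‖f y - f z₀ - f' (y - z₀)‖ ≤ (‖μ‖ + 1) * (ε / (‖μ‖ + 1) * ‖y - z₀‖) := by
    gcongr
    linarith
  have h5 : (‖μ‖ + 1) * (ε / (‖μ‖ + 1) * ‖y - z₀‖) = ε * ‖y - z₀‖ := by
    field_simp
  linarith [hμ _ hy]

/-- Local metric estimate for the constraint `f z ∈ K`, uniform over small elements of `K`. -/
def SubregularAt (f : Z → E) (S : Set Z) (K : ProperCone ℝ E) (κ r : ℝ) (z₀ : Z) : Prop :=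
  ∀ᶠ z in 𝓝 z₀, ∀ k ∈ K, ‖k‖ < r → ∃ z' ∈ S, ‖z' - z‖ ≤ κ * ‖f z - k‖

/-- For `d = k - σ f(z₀)` the point `f(z₀) + t d` lies in `K` for small `t`, so `z₀ + t u` is within
about `t κ‖f'u - d‖` of `S`. Since `ζ` is at most `o(t)` on the resulting feasible displacement, `ζ
u ≤ κ‖ζ‖‖f'u - d‖`, which is the penalty estimate with `b = 0` and `s = 0`. The term in `σ` produces
complementarity. -/
theorem exists_multiplier_of_mem_regularNormalCone {f : Z → E} {f' : Z →L[ℝ] E} {S : Set Z}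
    {z₀ : Z} {K : ProperCone ℝ E} {κ r : ℝ} {ζ : StrongDual ℝ Z} (hf : HasFDerivAt f f' z₀)
    (hfK : f z₀ ∈ K) (hfr : ‖f z₀‖ < r) (hκ : 0 ≤ κ) (hsub : SubregularAt f S K κ r z₀)
    (hζ : ζ ∈ regularNormalCone S z₀) :
    ∃ μ : StrongDual ℝ E, ‖μ‖ ≤ κ * ‖ζ‖ ∧ μ.comp f' = ζ ∧ (∀ k ∈ K, μ k ≤ 0) ∧ μ (f z₀) = 0 := by
  suffices h : ∀ u : Z, ∀ k ∈ K, ∀ σ : ℝ, 0 ≤ σ →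
      ζ u - 0 ≤ κ * ‖ζ‖ * ‖f' u + 0 - (k - σ • f z₀)‖ by
    obtain ⟨μ, h1, h2, h3, h4, -⟩ := exists_multiplier_of_penalty K f' 0 (f z₀) ζ 0 (κ * ‖ζ‖)
      (by positivity) h
    exact ⟨μ, h1, h2, h3, le_antisymm (h3 _ hfK) h4⟩
  intro u k hk σ hσ
  rw [sub_zero, add_zero]
  set d := k - σ • f z₀ with hd
  have main : ∀ ε : ℝ, 0 < ε →
      ζ u ≤ ‖ζ‖ * (κ * (‖f' u - d‖ + ε)) + ε * (‖u‖ + κ * (‖f' u - d‖ + ε)) := by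
    intro ε hε
    set M := ‖f' u - d‖ + ε with hM
    have hM0 : 0 ≤ M := by positivity
    have hlim : Tendsto (fun t : ℝ => z₀ + t • u) (𝓝[>] 0) (𝓝 z₀) := by
      have : Tendsto (fun t : ℝ => z₀ + t • u) (𝓝 0) (𝓝 (z₀ + (0 : ℝ) • u)) :=
        Continuous.tendsto (by fun_prop) 0
      simpa using this.mono_left nhdsWithin_le_nhds
    have h1 := hlim.eventually hsub
    have h2 := hlim.eventually (hf.isLittleO.def (c := ε / (‖u‖ + 1)) (by positivity))
    have h3 : ∀ᶠ t : ℝ in 𝓝[>] 0, ‖f z₀ + t • d‖ < r := by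
      have : Tendsto (fun t : ℝ => ‖f z₀ + t • d‖) (𝓝 0) (𝓝 ‖f z₀ + (0 : ℝ) • d‖) :=
        Continuous.tendsto (by fun_prop) 0
      rw [zero_smul, add_zero] at this
      exact (this.mono_left nhdsWithin_le_nhds).eventually_lt_const hfr
    have h4 : ∀ᶠ t : ℝ in 𝓝[>] 0, t * σ < 1 := by
      have : Tendsto (fun t : ℝ => t * σ) (𝓝 0) (𝓝 (0 * σ)) := Continuous.tendsto (by fun_prop) 0
      rw [zero_mul] at this
      exact (this.mono_left nhdsWithin_le_nhds).eventually_lt_const one_pos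
    obtain ⟨ρ, hρ, hball⟩ := Metric.eventually_nhds_iff.1
      (eventually_nhdsWithin_iff.1 (hζ.2 ε hε))
    have h5 : ∀ᶠ t : ℝ in 𝓝[>] 0, t * (‖u‖ + κ * M) < ρ := by
      have : Tendsto (fun t : ℝ => t * (‖u‖ + κ * M)) (𝓝 0) (𝓝 (0 * (‖u‖ + κ * M))) :=
        Continuous.tendsto (by fun_prop) 0
      rw [zero_mul] at this
      exact (this.mono_left nhdsWithin_le_nhds).eventually_lt_const hρ
    have h6 : ∀ᶠ t : ℝ in 𝓝[>] 0, 0 < t := eventually_mem_nhdsWithin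
    obtain ⟨t, h1, h2, h3, h4, h5, h6⟩ :=
      (h1.and (h2.and (h3.and (h4.and (h5.and h6))))).exists
    have hkK : f z₀ + t • d ∈ K := by
      have : f z₀ + t • d = t • k + (1 - t * σ) • f z₀ := by rw [hd]; module
      rw [this]
      exact K.add_mem (K.smul_mem hk h6.le) (K.smul_mem hfK (by linarith))
    obtain ⟨z', hz'S, hz'⟩ := h1 _ hkK h3
    have h7 : ‖f (z₀ + t • u) - (f z₀ + t • d)‖ ≤ t * M := by
      have e : f (z₀ + t • u) - (f z₀ + t • d) =
          (f (z₀ + t • u) - f z₀ - f' (z₀ + t • u - z₀)) + t • (f' u - d) := by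
        rw [add_sub_cancel_left, map_smul]
        module
      rw [e]
      refine (norm_add_le _ _).trans ?_
      rw [add_sub_cancel_left] at h2 ⊢
      rw [norm_smul, Real.norm_of_nonneg h6.le] at h2 ⊢
      have : ε / (‖u‖ + 1) * (t * ‖u‖) ≤ t * ε := by
        rw [div_mul_eq_mul_div, div_le_iff₀ (by positivity)]
        nlinarith [mul_pos hε h6]
      rw [hM]
      linarith
    have h8 : ‖z' - (z₀ + t • u)‖ ≤ t * (κ * M) := by
      refine hz'.trans ((mul_le_mul_of_nonneg_left h7 hκ).trans_eq (by ring))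
    have h9 : ‖z' - z₀‖ ≤ t * (‖u‖ + κ * M) := by
      have : z' - z₀ = (z' - (z₀ + t • u)) + t • u := by abel
      rw [this]
      refine (norm_add_le _ _).trans ?_
      rw [norm_smul, Real.norm_of_nonneg h6.le]
      linarith
    have h10 := hball (by rw [dist_eq_norm]; linarith) hz'S
    have h11 : t * ζ u = ζ (z' - z₀) - ζ (z' - (z₀ + t • u)) := by
      simp only [map_sub, map_add, map_smul, smul_eq_mul]
      ring
    have h12 : -ζ (z' - (z₀ + t • u)) ≤ ‖ζ‖ * (t * (κ * M)) :=
      (neg_le_abs _).trans ((ζ.le_opNorm _).trans (by gcongr))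
    have h13 : t * ζ u ≤ t * (‖ζ‖ * (κ * M) + ε * (‖u‖ + κ * M)) := by
      have := mul_le_mul_of_nonneg_left h9 hε.le
      rw [h11]
      linarith
    exact le_of_mul_le_mul_left h13 h6
  have hlim : Tendsto (fun ε : ℝ => ‖ζ‖ * (κ * (‖f' u - d‖ + ε)) +
      ε * (‖u‖ + κ * (‖f' u - d‖ + ε))) (𝓝[>] 0) (𝓝 (κ * ‖ζ‖ * ‖f' u - d‖)) := by
    have : Tendsto (fun ε : ℝ => ‖ζ‖ * (κ * (‖f' u - d‖ + ε)) +
      ε * (‖u‖ + κ * (‖f' u - d‖ + ε))) (𝓝 0) (𝓝 (‖ζ‖ * (κ * (‖f' u - d‖ + 0)) +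
      0 * (‖u‖ + κ * (‖f' u - d‖ + 0)))) := Continuous.tendsto (by fun_prop) 0
    convert this.mono_left nhdsWithin_le_nhds using 2
    ring
  exact ge_of_tendsto hlim (eventually_mem_nhdsWithin.mono fun ε hε => main ε hε)

/-- Extraction of a convergent subsequence from eventually bounded choices. -/
theorem exists_subseq_tendsto_of_bounded {F : Type*} [NormedAddCommGroup F] [ProperSpace F]
    {p : ℕ → F → Prop} {b : ℕ → ℝ} {β : ℝ} (hb : Tendsto b atTop (𝓝 β))
    (h : ∀ᶠ j in atTop, ∃ m, ‖m‖ ≤ b j ∧ p j m) :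
    ∃ φ : ℕ → ℕ, StrictMono φ ∧ ∃ (m : ℕ → F) (m₀ : F), Tendsto m atTop (𝓝 m₀) ∧
      ∀ j, ‖m j‖ ≤ b (φ j) ∧ p (φ j) (m j) := by
  -- Witnesses with a uniform bound exist only from `N` on, so all indices are shifted by `N`.
  obtain ⟨N, hN⟩ := eventually_atTop.1 (h.and (hb.eventually_lt_const (lt_add_one β)))
  choose m hm using fun j : ℕ => (hN (j + N) (Nat.le_add_left _ _)).1
  have hbd : ∀ j, m j ∈ Metric.closedBall (0 : F) (β + 1) := fun j => by
    rw [mem_closedBall_zero_iff]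
    exact (hm j).1.trans (hN (j + N) (Nat.le_add_left _ _)).2.le
  obtain ⟨m₀, -, φ, hφ, hlim⟩ := (isCompact_closedBall (0 : F) (β + 1)).tendsto_subseq hbd
  exact ⟨fun j => φ j + N, fun i j hij => Nat.add_lt_add_right (hφ hij) N, m ∘ φ, m₀, hlim,
    fun j => hm (φ j)⟩

theorem tendsto_clm_apply {ι F G : Type*} [NormedAddCommGroup F] [NormedSpace ℝ F]
    [NormedAddCommGroup G] [NormedSpace ℝ G] {l : Filter ι} {L : ι → F →L[ℝ] G} {L₀ : F →L[ℝ] G}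
    {x : ι → F} {x₀ : F} (hL : Tendsto L l (𝓝 L₀)) (hx : Tendsto x l (𝓝 x₀)) :
    Tendsto (fun i => L i (x i)) l (𝓝 (L₀ x₀)) :=
  ((by fun_prop : Continuous fun p : (F →L[ℝ] G) × F => p.1 p.2).tendsto (L₀, x₀)).comp
    (hL.prodMk_nhds hx)

theorem tendsto_clm_comp {ι D F G : Type*} [NormedAddCommGroup D] [NormedSpace ℝ D]
    [NormedAddCommGroup F] [NormedSpace ℝ F] [NormedAddCommGroup G] [NormedSpace ℝ G]
    {l : Filter ι} {L : ι → F →L[ℝ] G} {L₀ : F →L[ℝ] G} {M : ι → D →L[ℝ] F} {M₀ : D →L[ℝ] F}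
    (hL : Tendsto L l (𝓝 L₀)) (hM : Tendsto M l (𝓝 M₀)) :
    Tendsto (fun i => (L i).comp (M i)) l (𝓝 (L₀.comp M₀)) :=
  ((by fun_prop : Continuous fun p : (F →L[ℝ] G) × (D →L[ℝ] F) => p.1.comp p.2).tendsto
    (L₀, M₀)).comp (hL.prodMk_nhds hM)

/-- The bound by `κ` passes from regular normals at nearby points to the limit, because
subregularity near `z₀` holds at those points with the same constant. -/
theorem exists_multiplier_of_mem_normalCone [FiniteDimensional ℝ E] {f : Z → E} {S : Set Z}
    {z₀ : Z} {K : ProperCone ℝ E} {κ r : ℝ} {ζ : StrongDual ℝ Z} (hf : ContDiffAt ℝ 1 f z₀)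
    (hS : ∀ᶠ z in 𝓝[S] z₀, f z ∈ K) (hfr : ‖f z₀‖ < r) (hκ : 0 ≤ κ)
    (hsub : SubregularAt f S K κ r z₀) (hζ : ζ ∈ normalCone S z₀) :
    ∃ μ : StrongDual ℝ E, ‖μ‖ ≤ κ * ‖ζ‖ ∧ μ.comp (fderiv ℝ f z₀) = ζ ∧ (∀ k ∈ K, μ k ≤ 0) ∧
      μ (f z₀) = 0 := by
  obtain ⟨hz₀, y, ys, hy, hys, hreg⟩ := hζ
  have hyS : Tendsto y atTop (𝓝[S] z₀) :=
    tendsto_nhdsWithin_iff.2 ⟨hy, Eventually.of_forall fun k => (hreg k).1⟩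
  have hfy : Tendsto (fun j => f (y j)) atTop (𝓝 (f z₀)) := hf.continuousAt.tendsto.comp hy
  have hdiff : ∀ᶠ z in 𝓝 z₀, DifferentiableAt ℝ f z :=
    (hf.eventually (by simp)).mono fun z hz => hz.differentiableAt one_ne_zero
  have hev : ∀ᶠ j in atTop, ∃ μ : StrongDual ℝ E, ‖μ‖ ≤ κ * ‖ys j‖ ∧
      (μ.comp (fderiv ℝ f (y j)) = ys j ∧ (∀ k ∈ K, μ k ≤ 0) ∧ μ (f (y j)) = 0) := by
    filter_upwards [hyS.eventually hS, hy.eventually (eventually_eventually_nhds.2 hsub),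
      hfy.norm.eventually_lt_const hfr, hy.eventually hdiff] with j h1 h2 h3 h4
    exact exists_multiplier_of_mem_regularNormalCone h4.hasFDerivAt h1 h3 hκ h2 (hreg j)
  obtain ⟨φ, hφ, m, μ, hm, hp⟩ := exists_subseq_tendsto_of_bounded (hys.norm.const_mul κ) hev
  have hφ' := hφ.tendsto_atTop
  refine ⟨μ, ?_, ?_, ?_, ?_⟩
  · exact le_of_tendsto_of_tendsto' hm.norm ((hys.comp hφ').norm.const_mul κ) fun j => (hp j).1
  · have hd : Tendsto (fun j => fderiv ℝ f (y (φ j))) atTop (𝓝 (fderiv ℝ f z₀)) :=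
      (hf.continuousAt_fderiv one_ne_zero).tendsto.comp (hy.comp hφ')
    have h1 : Tendsto (fun j => (m j).comp (fderiv ℝ f (y (φ j)))) atTop
        (𝓝 (μ.comp (fderiv ℝ f z₀))) := tendsto_clm_comp hm hd
    refine tendsto_nhds_unique h1 ((hys.comp hφ').congr fun j => ?_)
    exact (hp j).2.1.symm
  · intro k hk
    exact le_of_tendsto' (tendsto_clm_apply hm tendsto_const_nhds) fun j => (hp j).2.2.1 k hk
  · refine tendsto_nhds_unique (tendsto_clm_apply hm (hfy.comp hφ')) ?_
    exact tendsto_const_nhds.congr fun j => ((hp j).2.2.2).symm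

/-- The normal cone to a convex cone. -/
theorem mem_normalCone_convexCone {Q : Set Z} (hQ : Convex ℝ Q)
    (hcone : ∀ w ∈ Q, ∀ c : ℝ, 0 ≤ c → c • w ∈ Q) {v : Z} {ζ : StrongDual ℝ Z} :
    ζ ∈ normalCone Q v ↔ v ∈ Q ∧ (∀ w ∈ Q, ζ w ≤ 0) ∧ ζ v = 0 := by
  have hreg : ∀ (y : Z) (ξ : StrongDual ℝ Z), ξ ∈ regularNormalCone Q y →
      ∀ w ∈ Q, ξ (w - y) ≤ 0 := by
    intro y ξ hξ w hw
    have main : ∀ ε : ℝ, 0 < ε → ξ (w - y) ≤ ε * ‖w - y‖ := by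
      intro ε hε
      have hlim : Tendsto (fun t : ℝ => y + t • (w - y)) (𝓝[>] 0) (𝓝[Q] y) := by
        refine tendsto_nhdsWithin_iff.2 ⟨?_, ?_⟩
        · have : Tendsto (fun t : ℝ => y + t • (w - y)) (𝓝 0) (𝓝 (y + (0 : ℝ) • (w - y))) :=
            Continuous.tendsto (by fun_prop) 0
          simpa using this.mono_left nhdsWithin_le_nhds
        · filter_upwards [Ioo_mem_nhdsGT (zero_lt_one (α := ℝ))] with t ht
          exact hQ.add_smul_sub_mem hξ.1 hw ⟨ht.1.le, ht.2.le⟩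
      obtain ⟨t, h1, h2⟩ := ((hlim.eventually (hξ.2 ε hε)).and
        (eventually_mem_nhdsWithin : ∀ᶠ t : ℝ in 𝓝[>] 0, t ∈ Ioi 0)).exists
      rw [add_sub_cancel_left, map_smul, norm_smul, Real.norm_of_nonneg (le_of_lt h2),
        smul_eq_mul] at h1
      exact le_of_mul_le_mul_left (by linarith) (mem_Ioi.1 h2)
    have hlim : Tendsto (fun ε : ℝ => ε * ‖w - y‖) (𝓝[>] 0) (𝓝 0) := by
      have : Tendsto (fun ε : ℝ => ε * ‖w - y‖) (𝓝 0) (𝓝 (0 * ‖w - y‖)) :=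
        Continuous.tendsto (by fun_prop) 0
      rw [zero_mul] at this
      exact this.mono_left nhdsWithin_le_nhds
    exact ge_of_tendsto hlim (eventually_mem_nhdsWithin.mono fun ε hε => main ε hε)
  constructor
  · rintro ⟨hv, y, ys, hy, hys, hr⟩
    have h1 : ∀ w ∈ Q, ζ (w - v) ≤ 0 := fun w hw =>
      le_of_tendsto' (tendsto_clm_apply hys (tendsto_const_nhds.sub hy)) fun k => hreg _ _ (hr k) w hw
    -- The test points `0` and `2 v` give the two signs of `ζ v`.
    have h0 := h1 0 (by simpa using hcone v hv 0 le_rfl)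
    have h2 := h1 ((2 : ℝ) • v) (hcone v hv 2 (by norm_num))
    simp only [map_sub, map_zero, map_smul, smul_eq_mul] at h0 h2
    have hζv : ζ v = 0 := by linarith
    refine ⟨hv, fun w hw => ?_, hζv⟩
    have := h1 w hw
    rw [map_sub] at this
    linarith
  · rintro ⟨hv, h1, h2⟩
    refine regularNormalCone_subset_normalCone _ _ ⟨hv, fun ε hε => ?_⟩
    filter_upwards [self_mem_nhdsWithin] with y hy
    rw [map_sub, h2]
    have := h1 y hy
    have : 0 ≤ ε * ‖y - v‖ := by positivity
    linarith

theorem tendsto_slope_of_hasFDerivAt {ι : Type*} {l : Filter ι} {f : Z → E} {f' : Z →L[ℝ] E}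
    {z₀ v : Z} (hf : HasFDerivAt f f' z₀) {t : ι → ℝ} {d : ι → Z} (ht : ∀ᶠ k in l, 0 < t k)
    (ht0 : Tendsto t l (𝓝 0)) (hd : Tendsto d l (𝓝 v)) :
    Tendsto (fun k => (t k)⁻¹ • (f (z₀ + t k • d k) - f z₀)) l (𝓝 (f' v)) := by
  refine hf.hasFDerivWithinAt.lim (s := univ) (by simpa using ht0.smul hd)
    (Eventually.of_forall fun _ => mem_univ _) (hd.congr' (ht.mono fun k hk => ?_))
  simp only [smul_smul, inv_mul_cancel₀ hk.ne', one_smul]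

/-- A linearized direction is tangent because subregularity with `k = t f'w` moves `z₀ + t w` into
`Ω` at cost `o(t)`. -/
theorem tangentCone_eq_of_subregular {f : Z → E} {f' : Z →L[ℝ] E} {Ω : Set Z} {z₀ : Z}
    {K : ProperCone ℝ E} {κ r : ℝ} (hf : HasFDerivAt f f' z₀) (hf0 : f z₀ = 0) (hr : 0 < r)
    (hΩ : ∀ᶠ z in 𝓝 z₀, (z ∈ Ω ↔ f z ∈ K)) (hκ : 0 ≤ κ) (hsub : SubregularAt f Ω K κ r z₀) :
    tangentCone Ω z₀ = {w | f' w ∈ K} := by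
  ext w
  constructor
  · rintro ⟨t, d, ht, ht0, hd, hmem⟩
    have hlim := tendsto_slope_of_hasFDerivAt hf (Eventually.of_forall ht) ht0 hd
    have hz : Tendsto (fun k => z₀ + t k • d k) atTop (𝓝 z₀) := by
      simpa using tendsto_const_nhds.add (ht0.smul hd)
    refine K.isClosed.mem_of_tendsto hlim ?_
    filter_upwards [hz.eventually hΩ] with k hk
    rw [hf0, sub_zero]
    exact K.smul_mem (hk.1 (hmem k)) (inv_nonneg.2 (ht k).le)
  · intro hw
    rw [mem_tangentCone_iff]
    intro ε hε
    have hlim : Tendsto (fun t : ℝ => z₀ + t • w) (𝓝[>] 0) (𝓝 z₀) := by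
      have : Tendsto (fun t : ℝ => z₀ + t • w) (𝓝 0) (𝓝 (z₀ + (0 : ℝ) • w)) :=
        Continuous.tendsto (by fun_prop) 0
      simpa using this.mono_left nhdsWithin_le_nhds
    have h3 : ∀ᶠ t : ℝ in 𝓝[>] 0, ‖t • f' w‖ < r := by
      have : Tendsto (fun t : ℝ => ‖t • f' w‖) (𝓝 0) (𝓝 ‖(0 : ℝ) • f' w‖) :=
        Continuous.tendsto (by fun_prop) 0
      rw [zero_smul, norm_zero] at this
      exact (this.mono_left nhdsWithin_le_nhds).eventually_lt_const hr
    obtain ⟨t, ⟨ht, htε⟩, h1, h2, h3⟩ := ((eventually_mem_set.2 (Ioo_mem_nhdsGT hε)).and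
      ((hlim.eventually hsub).and ((hlim.eventually (hf.isLittleO.def
        (c := ε / (2 * (κ + 1) * (‖w‖ + 1))) (by positivity))).and h3))).exists
    obtain ⟨z', hz', hn⟩ := h1 _ (K.smul_mem hw ht.le) h3
    refine ⟨t, ht, htε, t⁻¹ • (z' - z₀), ?_, ?_⟩
    · have e : t⁻¹ • (z' - z₀) - w = t⁻¹ • (z' - (z₀ + t • w)) := by
        rw [smul_sub, smul_sub, smul_add, smul_smul, inv_mul_cancel₀ ht.ne', one_smul]
        abel
      rw [hf0, sub_zero, add_sub_cancel_left, map_smul, norm_smul t, Real.norm_of_nonneg ht.le]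
        at h2
      rw [e, norm_smul, norm_inv, Real.norm_of_nonneg ht.le, inv_mul_lt_iff₀ ht]
      calc ‖z' - (z₀ + t • w)‖ ≤ κ * ‖f (z₀ + t • w) - t • f' w‖ := hn
        _ ≤ κ * (ε / (2 * (κ + 1) * (‖w‖ + 1)) * (t * ‖w‖)) := by gcongr
        _ ≤ (κ + 1) * (ε / (2 * (κ + 1) * (‖w‖ + 1)) * (t * (‖w‖ + 1))) := by
            gcongr <;> linarith
        _ = t * (ε / 2) := by field_simp
        _ < t * ε := by gcongr; linarith
    · rw [smul_smul, mul_inv_cancel₀ ht.ne', one_smul, add_sub_cancel]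
      exact hz'

/-- In finite dimensions the polar of the tangent cone consists of regular normals. -/
theorem mem_regularNormalCone_of_polar_tangentCone [FiniteDimensional ℝ Z] {Ω : Set Z} {z : Z}
    {ζ : StrongDual ℝ Z} (hz : z ∈ Ω) (hζ : ∀ w ∈ tangentCone Ω z, ζ w ≤ 0) :
    ζ ∈ regularNormalCone Ω z := by
  have : ProperSpace Z := FiniteDimensional.proper_real Z
  refine ⟨hz, fun ε hε => ?_⟩
  by_contra hcon
  rw [not_eventually] at hcon
  -- If the estimate fails along points tending to `z`, their unit directions cluster at a tangent
  -- vector on which `ζ` is at least `ε`.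
  have hex : ∀ n : ℕ, ∃ y ∈ Ω, ε * ‖y - z‖ < ζ (y - z) ∧ ‖y - z‖ < 1 / ((n : ℝ) + 1) := by
    intro n
    have h1 : ∀ᶠ y in 𝓝[Ω] z, y ∈ Ω ∧ ‖y - z‖ < 1 / ((n : ℝ) + 1) := by
      filter_upwards [self_mem_nhdsWithin, mem_nhdsWithin_of_mem_nhds
        (Metric.ball_mem_nhds z (by positivity : 0 < 1 / ((n : ℝ) + 1)))] with y h2 h3
      exact ⟨h2, by simpa [dist_eq_norm] using h3⟩
    obtain ⟨y, h2, h3, h4⟩ := (hcon.and_eventually h1).exists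
    exact ⟨y, h3, not_le.1 h2, h4⟩
  choose y hyΩ hyζ hyn using hex
  have hpos : ∀ n, 0 < ‖y n - z‖ := fun n => by
    refine (norm_nonneg _).lt_of_ne fun h => ?_
    have := hyζ n
    rw [norm_eq_zero.1 h.symm] at this
    simp at this
  have hsph : ∀ n, ‖y n - z‖⁻¹ • (y n - z) ∈ Metric.sphere (0 : Z) 1 := fun n => by
    rw [mem_sphere_zero_iff_norm, norm_smul, norm_inv, norm_norm, inv_mul_cancel₀ (hpos n).ne']
  obtain ⟨u, -, φ, hφ, hlim⟩ := (isCompact_sphere (0 : Z) 1).tendsto_subseq hsph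
  have hu : u ∈ tangentCone Ω z := by
    refine ⟨fun n => ‖y (φ n) - z‖, fun n => ‖y (φ n) - z‖⁻¹ • (y (φ n) - z), fun n => hpos _,
      ?_, hlim, fun n => ?_⟩
    · exact (squeeze_zero (fun n => norm_nonneg _) (fun n => (hyn n).le)
        tendsto_one_div_add_atTop_nhds_zero_nat).comp hφ.tendsto_atTop
    · rw [smul_smul, mul_inv_cancel₀ (hpos _).ne', one_smul, add_sub_cancel]
      exact hyΩ _
  have h1 : ε ≤ ζ u := by
    refine ge_of_tendsto' ((ζ.continuous.tendsto u).comp hlim) fun n => ?_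
    rw [Function.comp_apply, Function.comp_apply, map_smul, smul_eq_mul,
      le_inv_mul_iff₀ (hpos _)]
    linarith [hyζ (φ n)]
  linarith [hζ u hu]

end Normals

/-! ### Second-order expansions along converging directions. -/

section Taylor

variable {Z E : Type*} [NormedAddCommGroup Z] [NormedSpace ℝ Z] [NormedAddCommGroup E]
  [NormedSpace ℝ E]

theorem hasFDerivAt_fderiv_of_contDiffAt_two {G : Z → E} {z₀ : Z} (hG : ContDiffAt ℝ 2 G z₀) :
    HasFDerivAt (fderiv ℝ G) (hess G z₀) z₀ :=
  ((hG.fderiv_right (m := 1) (by norm_num)).differentiableAt one_ne_zero).hasFDerivAt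

/-- Second-order Taylor expansion. -/
theorem isLittleO_taylor_two {G : Z → E} {z₀ : Z} (hG : ContDiffAt ℝ 2 G z₀) :
    (fun w => G (z₀ + w) - G z₀ - fderiv ℝ G z₀ w - (1 / 2 : ℝ) • hess G z₀ w w)
      =o[𝓝 0] fun w => ‖w‖ ^ 2 := by
  have hsymm : ∀ v w, hess G z₀ v w = hess G z₀ w v := fun v w =>
    (hG.isSymmSndFDerivAt (by simp)).eq v w
  rw [Asymptotics.isLittleO_iff]
  intro ε hε
  have hadd : Tendsto (fun w : Z => z₀ + w) (𝓝 0) (𝓝 z₀) := by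
    simpa using (by fun_prop : Continuous fun w : Z => z₀ + w).tendsto 0
  have h1 := hadd.eventually ((hasFDerivAt_fderiv_of_contDiffAt_two hG).isLittleO.def hε)
  have h2 : ∀ᶠ w in 𝓝 (0 : Z), DifferentiableAt ℝ G (z₀ + w) :=
    hadd.eventually ((hG.eventually (by simp)).mono fun z hz => hz.differentiableAt two_ne_zero)
  obtain ⟨δ, hδ, hball⟩ := Metric.eventually_nhds_iff.1 (h1.and h2)
  filter_upwards [Metric.ball_mem_nhds (0 : Z) hδ] with w hw
  rw [Metric.mem_ball, dist_zero_right] at hw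
  -- By symmetry of the Hessian, the derivative of the remainder is the first-order remainder of
  -- `∇G`, of norm at most `ε‖w‖` on this ball; the mean value inequality then gives `ε‖w‖²`.
  have hd : ∀ x ∈ Metric.closedBall (0 : Z) ‖w‖, HasFDerivWithinAt
      (fun w => G (z₀ + w) - G z₀ - fderiv ℝ G z₀ w - (1 / 2 : ℝ) • hess G z₀ w w)
      (fderiv ℝ G (z₀ + x) - fderiv ℝ G z₀ - hess G z₀ x) (Metric.closedBall 0 ‖w‖) x := by
    intro x hx
    rw [mem_closedBall_zero_iff] at hx
    have hx2 := (hball (y := x) (by rw [dist_zero_right]; linarith)).2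
    have e1 : HasFDerivAt (fun w => G (z₀ + w)) (fderiv ℝ G (z₀ + x)) x := by
      have h := hx2.hasFDerivAt.comp x ((hasFDerivAt_id x).const_add z₀)
      rwa [ContinuousLinearMap.comp_id] at h
    have e2 : HasFDerivAt (fun w => hess G z₀ w w)
        ((hess G z₀ x).comp (ContinuousLinearMap.id ℝ Z) + (hess G z₀).flip x) x :=
      (hess G z₀).hasFDerivAt.clm_apply (hasFDerivAt_id x)
    refine (((e1.sub_const (G z₀)).sub (fderiv ℝ G z₀).hasFDerivAt).sub
      (e2.const_smul (1 / 2 : ℝ))).hasFDerivWithinAt.congr_fderiv ?_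
    ext y
    simp only [_root_.sub_apply, _root_.add_apply, _root_.smul_apply,
      ContinuousLinearMap.comp_id, ContinuousLinearMap.flip_apply, hsymm y x]
    module
  have hb : ∀ x ∈ Metric.closedBall (0 : Z) ‖w‖,
      ‖fderiv ℝ G (z₀ + x) - fderiv ℝ G z₀ - hess G z₀ x‖ ≤ ε * ‖w‖ := by
    intro x hx
    rw [mem_closedBall_zero_iff] at hx
    have := (hball (y := x) (by rw [dist_zero_right]; linarith)).1
    rw [add_sub_cancel_left] at this
    exact this.trans (by gcongr)
  have := (convex_closedBall (0 : Z) ‖w‖).norm_image_sub_le_of_norm_hasFDerivWithin_le hd hb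
    (by simp : (0 : Z) ∈ _) (by simp : w ∈ _)
  simp only [add_zero, sub_self, map_zero, smul_zero, sub_zero] at this
  rw [norm_pow, norm_norm]
  nlinarith

theorem tendsto_fderiv_quotient {ι : Type*} {l : Filter ι} {G : Z → E} {z₀ v : Z} (hG : ContDiffAt ℝ 2 G z₀) {t : ι → ℝ}
    {d : ι → Z} (ht : ∀ᶠ k in l, 0 < t k) (ht0 : Tendsto t l (𝓝 0)) (hd : Tendsto d l (𝓝 v)) :
    Tendsto (fun k => (t k)⁻¹ • (fderiv ℝ G (z₀ + t k • d k) - fderiv ℝ G z₀)) l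
      (𝓝 (hess G z₀ v)) :=
  tendsto_slope_of_hasFDerivAt (hasFDerivAt_fderiv_of_contDiffAt_two hG) ht ht0 hd

/-- The linear term is evaluated at `d k` rather than `v`, since `(d k - v) / t k` need not be
bounded. -/
theorem tendsto_second_quotient {ι : Type*} {l : Filter ι} {G : Z → E} {z₀ v : Z} (hG : ContDiffAt ℝ 2 G z₀) {t : ι → ℝ}
    {d : ι → Z} (ht : ∀ᶠ k in l, 0 < t k) (ht0 : Tendsto t l (𝓝 0)) (hd : Tendsto d l (𝓝 v)) :
    Tendsto (fun k => (t k ^ 2)⁻¹ • (G (z₀ + t k • d k) - G z₀ - t k • fderiv ℝ G z₀ (d k))) l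
      (𝓝 ((1 / 2 : ℝ) • hess G z₀ v v)) := by
  have hw : Tendsto (fun k => t k • d k) l (𝓝 0) := by simpa using ht0.smul hd
  have hO : (fun k => ‖t k • d k‖ ^ 2) =O[l] fun k => t k ^ 2 := by
    have h1 : (fun k => t k • d k) =O[l] fun k => t k • (1 : ℝ) :=
      (Asymptotics.isBigO_refl t l).smul (hd.isBigO_one ℝ)
    simpa using h1.norm_left.pow 2
  have h1 := (((isLittleO_taylor_two hG).comp_tendsto hw).trans_isBigO hO).tendsto_inv_smul_nhds_zero
  have h2 : Tendsto (fun k => (1 / 2 : ℝ) • hess G z₀ (d k) (d k)) l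
      (𝓝 ((1 / 2 : ℝ) • hess G z₀ v v)) :=
    (tendsto_clm_apply (tendsto_clm_apply tendsto_const_nhds hd) hd).const_smul _
  have h3 := h1.add h2
  rw [zero_add] at h3
  refine h3.congr' (ht.mono fun k htk => ?_)
  have hk : t k ≠ 0 := htk.ne'
  simp only [Function.comp_apply, map_smul, _root_.smul_apply]
  have : (1 / 2 : ℝ) • hess G z₀ (d k) (d k) =
      (t k ^ 2)⁻¹ • ((1 / 2 : ℝ) • t k • t k • hess G z₀ (d k) (d k)) := by
    simp only [smul_smul]
    congr 1
    field_simp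
  rw [this, ← smul_add]
  congr 1
  abel

end Taylor

/-! ### The reduced constraint `G z ∈ K` and necessary conditions for tangents to the normal cone
graph. -/

section ReducedSystem

variable {Z E : Type*} [NormedAddCommGroup Z] [NormedSpace ℝ Z] [NormedAddCommGroup E]
  [NormedSpace ℝ E]

/-- Near `z₀`, the set `Ω` is the solution set of `G z ∈ K`, where `G` is `C²` with `G z₀ = 0`, and
the constraint is metrically subregular. -/
structure ReducedSystem (G : Z → E) (Ω : Set Z) (K : ProperCone ℝ E) (κ r : ℝ) (z₀ : Z) :
    Prop where
  contDiffAt : ContDiffAt ℝ 2 G z₀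
  map_eq_zero : G z₀ = 0
  mem_iff : ∀ᶠ z in 𝓝 z₀, (z ∈ Ω ↔ G z ∈ K)
  nonneg : 0 ≤ κ
  pos : 0 < r
  subregular : SubregularAt G Ω K κ r z₀

variable {G : Z → E} {Ω : Set Z} {K : ProperCone ℝ E} {κ r : ℝ} {z₀ : Z}

theorem ReducedSystem.mem (hs : ReducedSystem G Ω K κ r z₀) : z₀ ∈ Ω :=
  hs.mem_iff.self_of_nhds.2 (by rw [hs.map_eq_zero]; exact K.zero_mem)

theorem ReducedSystem.eventually_differentiableAt (hs : ReducedSystem G Ω K κ r z₀) :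
    ∀ᶠ z in 𝓝 z₀, DifferentiableAt ℝ G z :=
  (hs.contDiffAt.eventually (by simp)).mono fun _ hz => hz.differentiableAt two_ne_zero

theorem ReducedSystem.hasFDerivAt (hs : ReducedSystem G Ω K κ r z₀) :
    HasFDerivAt G (fderiv ℝ G z₀) z₀ := hs.eventually_differentiableAt.self_of_nhds.hasFDerivAt

theorem ReducedSystem.tangentCone_eq (hs : ReducedSystem G Ω K κ r z₀) :
    tangentCone Ω z₀ = {w | fderiv ℝ G z₀ w ∈ K} :=
  tangentCone_eq_of_subregular hs.hasFDerivAt hs.map_eq_zero hs.pos hs.mem_iff hs.nonneg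
    hs.subregular

/-- One constant `κ` serves all points near `z₀`; this uniformity is what makes multipliers along
sequences precompact. -/
theorem ReducedSystem.eventually_exists_multiplier [FiniteDimensional ℝ E]
    (hs : ReducedSystem G Ω K κ r z₀) : ∀ᶠ z in 𝓝 z₀, ∀ ζ ∈ normalCone Ω z,
      G z ∈ K ∧ ∃ μ : StrongDual ℝ E, ‖μ‖ ≤ κ * ‖ζ‖ ∧ μ.comp (fderiv ℝ G z) = ζ ∧
        (∀ k ∈ K, μ k ≤ 0) ∧ μ (G z) = 0 := by
  have h1 : ∀ᶠ z in 𝓝 z₀, ‖G z‖ < r := by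
    have := hs.contDiffAt.continuousAt.tendsto.norm
    rw [hs.map_eq_zero, norm_zero] at this
    exact this.eventually_lt_const hs.pos
  filter_upwards [h1, eventually_eventually_nhds.2 hs.mem_iff,
    eventually_eventually_nhds.2 hs.subregular, hs.contDiffAt.eventually (by simp)]
    with z h1 h2 h3 h4 ζ hζ
  refine ⟨h2.self_of_nhds.1 hζ.1, exists_multiplier_of_mem_normalCone (h4.of_le (by norm_num)) ?_ h1
    hs.nonneg h3 hζ⟩
  filter_upwards [self_mem_nhdsWithin, mem_nhdsWithin_of_mem_nhds h2] with y hy hy'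
  exact hy'.1 hy

theorem ReducedSystem.eventually_comp_mem_normalCone (hs : ReducedSystem G Ω K κ r z₀) :
    ∀ᶠ z in 𝓝 z₀, G z ∈ K → ∀ μ : StrongDual ℝ E, (∀ k ∈ K, μ k ≤ 0) → μ (G z) = 0 →
      μ.comp (fderiv ℝ G z) ∈ normalCone Ω z := by
  filter_upwards [eventually_eventually_nhds.2 hs.mem_iff, hs.eventually_differentiableAt]
    with z h1 h2 hz μ hμ hμz
  refine regularNormalCone_subset_normalCone _ _ (comp_mem_regularNormalCone h2.hasFDerivAt
    (h1.self_of_nhds.2 hz) ?_ hμ hμz)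
  filter_upwards [self_mem_nhdsWithin, mem_nhdsWithin_of_mem_nhds h1] with y hy hy'
  exact hy'.1 hy

theorem tendsto_add_smul_nhds {ι : Type*} {l : Filter ι} {t : ι → ℝ} {d : ι → Z} {v : Z}
    (ht0 : Tendsto t l (𝓝 0)) (hd : Tendsto d l (𝓝 v)) :
    Tendsto (fun k => z₀ + t k • d k) l (𝓝 z₀) := by
  simpa using tendsto_const_nhds.add (ht0.smul hd)

theorem map_fderiv_mem_of_tendsto (hG : ContDiffAt ℝ 2 G z₀) (hG0 : G z₀ = 0) {t : ℕ → ℝ}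
    {d : ℕ → Z} {v : Z} (ht : ∀ k, 0 < t k) (ht0 : Tendsto t atTop (𝓝 0))
    (hd : Tendsto d atTop (𝓝 v)) (hK : ∀ᶠ k in atTop, G (z₀ + t k • d k) ∈ K) :
    fderiv ℝ G z₀ v ∈ K := by
  have hlim := tendsto_slope_of_hasFDerivAt (hG.differentiableAt two_ne_zero).hasFDerivAt
    (Eventually.of_forall ht) ht0 hd
  refine K.isClosed.mem_of_tendsto hlim (hK.mono fun k hk => ?_)
  rw [hG0, sub_zero]
  exact K.smul_mem hk (inv_nonneg.2 (ht k).le)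

/-- The limiting conditions satisfied by multipliers along a sequence of constraint solutions. -/
theorem critical_of_tendsto_multipliers (hG : ContDiffAt ℝ 2 G z₀) (hG0 : G z₀ = 0)
    {t : ℕ → ℝ} {d : ℕ → Z} {v : Z} {m : ℕ → StrongDual ℝ E} {μ : StrongDual ℝ E}
    {ω : StrongDual ℝ Z} (ht : ∀ k, 0 < t k) (ht0 : Tendsto t atTop (𝓝 0))
    (hd : Tendsto d atTop (𝓝 v)) (hm : Tendsto m atTop (𝓝 μ)) (hpol : ∀ j, ∀ k ∈ K, m j k ≤ 0)
    (hcompl : ∀ j, m j (G (z₀ + t j • d j)) = 0) (hK : ∀ j, G (z₀ + t j • d j) ∈ K)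
    (hω : Tendsto (fun j => (t j)⁻¹ • (m j - μ).comp (fderiv ℝ G z₀)) atTop (𝓝 ω)) :
    (∀ k ∈ K, μ k ≤ 0) ∧ fderiv ℝ G z₀ v ∈ K ∧ μ (fderiv ℝ G z₀ v) = 0 ∧
      (∀ w, fderiv ℝ G z₀ w ∈ K → μ (fderiv ℝ G z₀ w) = 0 → ω w ≤ 0) ∧ ω v = 0 ∧
      ∀ μ' : StrongDual ℝ E, (∀ k ∈ K, μ' k ≤ 0) →
        μ'.comp (fderiv ℝ G z₀) = μ.comp (fderiv ℝ G z₀) →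
        μ' (hess G z₀ v v) ≤ μ (hess G z₀ v v) := by
  set A := fderiv ℝ G z₀ with hA
  have hμ : ∀ k ∈ K, μ k ≤ 0 := fun k hk =>
    le_of_tendsto' (tendsto_clm_apply hm tendsto_const_nhds) fun j => hpol j k hk
  have hAv : A v ∈ K := map_fderiv_mem_of_tendsto hG hG0 ht ht0 hd (Eventually.of_forall hK)
  have hq := tendsto_second_quotient hG (Eventually.of_forall ht) ht0 hd
  simp only [hG0, sub_zero] at hq
  set q : ℕ → E := fun j => (t j ^ 2)⁻¹ • (G (z₀ + t j • d j) - t j • A (d j)) with hqdef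
  have hGq : ∀ j, G (z₀ + t j • d j) = t j • A (d j) + t j ^ 2 • q j := fun j => by
    rw [hqdef]
    simp only
    rw [smul_smul, mul_inv_cancel₀ (pow_pos (ht j) 2).ne', one_smul]
    abel
  have hμv : μ (A v) = 0 := by
    have hlim := tendsto_slope_of_hasFDerivAt (hG.differentiableAt two_ne_zero).hasFDerivAt
      (Eventually.of_forall ht) ht0 hd
    refine tendsto_nhds_unique (tendsto_clm_apply hm hlim) (tendsto_const_nhds.congr fun j => ?_)
    rw [hG0, sub_zero, map_smul, hcompl, smul_zero]
  have hωv : Tendsto (fun j => (t j)⁻¹ * (m j - μ) (A (d j))) atTop (𝓝 (ω v)) := by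
    simpa using tendsto_clm_apply hω hd
  have hdiff : Tendsto (fun j => m j - μ) atTop (𝓝 0) := by
    simpa using hm.sub_const μ
  have hdq : Tendsto (fun j => (m j - μ) (q j)) atTop (𝓝 0) := by
    simpa using tendsto_clm_apply hdiff hq
  have hω0 : ω v = 0 := by
    refine le_antisymm ?_ ?_
    -- Here `ω v` is approached along `A v ∈ K`, where `μ` vanishes and every `m j` is nonpositive.
    -- The reverse sign comes from `(m j - μ)(G z_j) ≥ 0`, divided by `t²`.
    · have : Tendsto (fun j => (t j)⁻¹ * (m j - μ) (A v)) atTop (𝓝 (ω v)) := by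
        simpa using tendsto_clm_apply hω (tendsto_const_nhds (x := v))
      refine le_of_tendsto' this fun j => ?_
      rw [_root_.sub_apply, hμv, sub_zero]
      exact mul_nonpos_of_nonneg_of_nonpos (inv_nonneg.2 (ht j).le) (hpol j _ hAv)
    · have h1 := hωv.add hdq
      rw [add_zero] at h1
      refine ge_of_tendsto' h1 fun j => ?_
      have h2 := hcompl j
      have h3 := hμ _ (hK j)
      have htj := ht j
      rw [hGq, map_add, map_smul, map_smul, smul_eq_mul, smul_eq_mul] at h2 h3
      replace h2 : m j (A (d j)) + t j * m j (q j) = 0 := (mul_eq_zero.1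
        (by linarith : t j * (m j (A (d j)) + t j * m j (q j)) = 0)).resolve_left htj.ne'
      have h4 : (t j)⁻¹ * (m j - μ) (A (d j)) + (m j - μ) (q j) =
          (t j ^ 2)⁻¹ * -(t j * μ (A (d j)) + t j ^ 2 * μ (q j)) := by
        simp only [_root_.sub_apply]
        field_simp
        linarith
      rw [h4]
      exact mul_nonneg (by positivity) (by linarith)
  refine ⟨hμ, hAv, hμv, fun w hw hμw => ?_, hω0, fun μ' hμ' hcomp => ?_⟩
  · have : Tendsto (fun j => (t j)⁻¹ * (m j - μ) (A w)) atTop (𝓝 (ω w)) := by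
      simpa using tendsto_clm_apply hω (tendsto_const_nhds (x := w))
    refine le_of_tendsto' this fun j => ?_
    rw [_root_.sub_apply, hμw, sub_zero]
    exact mul_nonpos_of_nonneg_of_nonpos (inv_nonneg.2 (ht j).le) (hpol j _ hw)
  -- Maximality of `μ`: expand `μ'(G z_j) ≤ 0 = m j (G z_j)` to second order. The first-order parts
  -- of `μ'` and `μ` agree, and what remains of the first order tends to `ω v = 0`.
  · have h1 : Tendsto (fun j => (μ' - m j) (q j) - (t j)⁻¹ * (m j - μ) (A (d j))) atTop
        (𝓝 ((μ' - μ) ((1 / 2 : ℝ) • hess G z₀ v v) - ω v)) :=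
      (tendsto_clm_apply (tendsto_const_nhds.sub hm) hq).sub hωv
    have h2 : (μ' - μ) ((1 / 2 : ℝ) • hess G z₀ v v) - ω v ≤ 0 := by
      refine le_of_tendsto' h1 fun j => ?_
      have h2 := hcompl j
      have h3 := hμ' _ (hK j)
      have htj := ht j
      have h5 : μ' (A (d j)) = μ (A (d j)) := DFunLike.congr_fun hcomp (d j)
      rw [hGq, map_add, map_smul, map_smul, smul_eq_mul, smul_eq_mul] at h2 h3
      replace h2 : m j (A (d j)) + t j * m j (q j) = 0 := (mul_eq_zero.1
        (by linarith : t j * (m j (A (d j)) + t j * m j (q j)) = 0)).resolve_left htj.ne'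
      have h4 : (μ' - m j) (q j) - (t j)⁻¹ * (m j - μ) (A (d j)) =
          (t j ^ 2)⁻¹ * (t j * μ' (A (d j)) + t j ^ 2 * μ' (q j)) := by
        simp only [_root_.sub_apply, h5]
        field_simp
        linarith
      rw [h4]
      exact mul_nonpos_of_nonneg_of_nonpos (by positivity) h3
    rw [hω0, map_smul, _root_.sub_apply, smul_eq_mul] at h2
    linarith

/-- A discrete product rule: after subtraction only `m j` composed with the difference quotient of
`∇G` is left. No convergence of `(m j - μ) / t j` is needed. -/
theorem tendsto_multiplier_quotient (hG : ContDiffAt ℝ 2 G z₀) {t : ℕ → ℝ} {d : ℕ → Z} {v : Z}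
    {m : ℕ → StrongDual ℝ E} {μ : StrongDual ℝ E} (ht : ∀ k, 0 < t k)
    (ht0 : Tendsto t atTop (𝓝 0)) (hd : Tendsto d atTop (𝓝 v)) (hm : Tendsto m atTop (𝓝 μ)) :
    Tendsto (fun j => (t j)⁻¹ • ((m j).comp (fderiv ℝ G (z₀ + t j • d j)) -
      μ.comp (fderiv ℝ G z₀)) - (t j)⁻¹ • (m j - μ).comp (fderiv ℝ G z₀)) atTop
      (𝓝 (μ.comp (hess G z₀ v))) := by
  refine (tendsto_clm_comp hm
    (tendsto_fderiv_quotient hG (Eventually.of_forall ht) ht0 hd)).congr fun j => ?_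
  ext w
  simp
  ring

/-- The multipliers representing `ζ`. -/
def reducedMultipliers (A : Z →L[ℝ] E) (K : ProperCone ℝ E) (ζ : StrongDual ℝ Z) :
    Set (StrongDual ℝ E) :=
  {μ | (∀ k ∈ K, μ k ≤ 0) ∧ μ.comp A = ζ}

/-- The second-order system describing tangents to the graph of the normal cone mapping:
`v` is critical, `μ` is a directional multiplier, and `ω` is normal to the critical cone at `v`. -/
structure SecondOrderSystem (A : Z →L[ℝ] E) (b : E) (K : ProperCone ℝ E) (ζ : StrongDual ℝ Z)
    (v : Z) (μ : StrongDual ℝ E) (ω : StrongDual ℝ Z) : Prop where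
  mem : μ ∈ reducedMultipliers A K ζ
  isMax : ∀ μ' ∈ reducedMultipliers A K ζ, μ' b ≤ μ b
  map_mem : A v ∈ K
  critical : ζ v = 0
  polar : ∀ w, A w ∈ K → ζ w = 0 → ω w ≤ 0
  orth : ω v = 0

theorem ReducedSystem.exists_of_mem_tangentCone_gph [FiniteDimensional ℝ E]
    (hs : ReducedSystem G Ω K κ r z₀) {ζ vs : StrongDual ℝ Z} {v : Z}
    (h : (v, vs) ∈ tangentCone (gph (normalCone Ω)) (z₀, ζ)) :
    ∃ μ ω, SecondOrderSystem (fderiv ℝ G z₀) (hess G z₀ v v) K ζ v μ ω ∧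
      vs = μ.comp (hess G z₀ v) + ω := by
  obtain ⟨t, p, ht, ht0, hp, hmem⟩ := h
  have hd : Tendsto (fun k => (p k).1) atTop (𝓝 v) := (continuous_fst.tendsto _).comp hp
  have hds : Tendsto (fun k => (p k).2) atTop (𝓝 vs) := (continuous_snd.tendsto _).comp hp
  have hmem' : ∀ k, ζ + t k • (p k).2 ∈ normalCone Ω (z₀ + t k • (p k).1) := hmem
  have hz := tendsto_add_smul_nhds (z₀ := z₀) ht0 hd
  have hζ : Tendsto (fun k => ζ + t k • (p k).2) atTop (𝓝 ζ) := tendsto_add_smul_nhds ht0 hds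
  have hev : ∀ᶠ j in atTop, ∃ μ : StrongDual ℝ E, ‖μ‖ ≤ κ * ‖ζ + t j • (p j).2‖ ∧
      (μ.comp (fderiv ℝ G (z₀ + t j • (p j).1)) = ζ + t j • (p j).2 ∧ (∀ k ∈ K, μ k ≤ 0) ∧
        μ (G (z₀ + t j • (p j).1)) = 0 ∧ G (z₀ + t j • (p j).1) ∈ K) := by
    filter_upwards [hz.eventually hs.eventually_exists_multiplier] with j hj
    obtain ⟨hK, μ, h1, h2, h3, h4⟩ := hj _ (hmem' j)
    exact ⟨μ, h1, h2, h3, h4, hK⟩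
  obtain ⟨φ, hφ, m, μ, hm, hprop⟩ := exists_subseq_tendsto_of_bounded (hζ.norm.const_mul κ) hev
  have hφ' := hφ.tendsto_atTop
  have hdc : Tendsto (fun k => fderiv ℝ G (z₀ + t k • (p k).1)) atTop (𝓝 (fderiv ℝ G z₀)) :=
    ((hs.contDiffAt.of_le (by norm_num)).continuousAt_fderiv one_ne_zero).tendsto.comp hz
  have hμζ : μ.comp (fderiv ℝ G z₀) = ζ := by
    refine tendsto_nhds_unique (tendsto_clm_comp hm (hdc.comp hφ')) ((hζ.comp hφ').congr fun j => ?_)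
    exact (hprop j).2.1.symm
  have hquot := tendsto_multiplier_quotient hs.contDiffAt (fun k => ht (φ k)) (ht0.comp hφ')
    (hd.comp hφ') hm
  have hω : Tendsto (fun j => (t (φ j))⁻¹ • (m j - μ).comp (fderiv ℝ G z₀)) atTop
      (𝓝 (vs - μ.comp (hess G z₀ v))) := by
    refine ((hds.comp hφ').sub hquot).congr fun j => ?_
    have h1 := (hprop j).2.1
    simp only [Function.comp_apply] at h1 ⊢
    rw [h1, hμζ, add_sub_cancel_left, smul_smul, inv_mul_cancel₀ (ht _).ne', one_smul]
    abel
  obtain ⟨h1, h2, h3, h4, h5, h6⟩ := critical_of_tendsto_multipliers hs.contDiffAt hs.map_eq_zero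
    (fun k => ht (φ k)) (ht0.comp hφ') (hd.comp hφ') hm (fun j => (hprop j).2.2.1)
    (fun j => (hprop j).2.2.2.1) (fun j => (hprop j).2.2.2.2) hω
  have hap : ∀ w, ζ w = μ (fderiv ℝ G z₀ w) := fun w => by rw [← hμζ]; rfl
  refine ⟨μ, _, ⟨⟨h1, hμζ⟩, fun μ' hμ' => h6 μ' hμ'.1 (hμ'.2.trans hμζ.symm), h2,
    (hap v).trans h3, fun w hw hw' => h4 w hw ((hap w).symm.trans hw'), h5⟩, ?_⟩
  abel

end ReducedSystem

/-! ### Sufficient conditions: constructing normals by penalized minimization. -/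

section Sufficiency

variable {Z E : Type*} [NormedAddCommGroup Z] [NormedSpace ℝ Z] [NormedAddCommGroup E]
  [NormedSpace ℝ E] {G : Z → E} {Ω : Set Z} {K : ProperCone ℝ E} {κ r : ℝ} {z₀ : Z}

theorem tendsto_nhdsGT_zero_of_continuous {F : Type*} [TopologicalSpace F] {f : ℝ → F}
    (hf : Continuous f) {y : F} (h : f 0 = y) : Tendsto f (𝓝[>] 0) (𝓝 y) := by
  rw [← h]
  exact (hf.tendsto 0).mono_left nhdsWithin_le_nhds

/-- Second-order feasible arcs that are nearly optimal for the linear functional `ζ`. -/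
theorem ReducedSystem.exists_nearly_optimal_arc (hs : ReducedSystem G Ω K κ r z₀)
    {ζ ω : StrongDual ℝ Z} {v : Z} {μ : StrongDual ℝ E}
    (hsys : SecondOrderSystem (fderiv ℝ G z₀) (hess G z₀ v v) K ζ v μ ω) {ε : ℝ} (hε : 0 < ε) :
    ∃ c : ℝ, 0 ≤ c ∧ ∀ᶠ t : ℝ in 𝓝[>] 0, ∃ z ∈ Ω, ‖z - z₀ - t • v‖ ≤ c * t ^ 2 ∧
      -ζ (z - z₀) ≤ t ^ 2 * ((μ (hess G z₀ v v) + ε) / 2) := by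
  set A := fderiv ℝ G z₀ with hA
  set b := hess G z₀ v v with hb
  have hκ := hs.nonneg
  -- Otherwise the multiplier rule with `s = -μ b - ε` would give a multiplier `μ'` with `μ' b ≥ μ b
  -- + ε`, against the maximality of `μ`.
  obtain ⟨u, k, hk, σ, hσ, hlt⟩ : ∃ u : Z, ∃ k ∈ K, ∃ σ : ℝ, 0 ≤ σ ∧
      κ * ‖ζ‖ * ‖A u + b - (k - σ • A v)‖ < ζ u - (-μ b - ε) := by
    by_contra! hcon
    obtain ⟨μ', -, h1, h2, -, h3⟩ := exists_multiplier_of_penalty K A b (A v) ζ (-μ b - ε)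
      (κ * ‖ζ‖) (by positivity) hcon
    have := hsys.isMax μ' ⟨h2, h1⟩
    linarith
  set D := k - σ • A v with hD
  set N := ‖A u + b - D‖ with hN
  set γ := ζ u - (-μ b - ε) - κ * ‖ζ‖ * N with hγ
  have hγ0 : 0 < γ := by linarith
  -- The strict gap `γ` absorbs the Taylor error: half of it covers `κ‖ζ‖δ`.
  set δ := γ / (2 * (κ * ‖ζ‖ + 1)) with hδ
  have hδ0 : 0 < δ := by positivity
  have hδ1 : κ * ‖ζ‖ * δ ≤ γ / 2 := by
    rw [hδ, mul_div_assoc', div_le_iff₀ (by positivity)]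
    nlinarith
  refine ⟨‖u‖ / 2 + κ * (N / 2 + δ), by positivity, ?_⟩
  have hd : Tendsto (fun t : ℝ => v + (t / 2) • u) (𝓝[>] 0) (𝓝 v) :=
    tendsto_nhdsGT_zero_of_continuous (by fun_prop) (by simp)
  have ht0 : Tendsto (fun t : ℝ => t) (𝓝[>] 0) (𝓝 0) :=
    tendsto_nhdsGT_zero_of_continuous continuous_id rfl
  have hpos : ∀ᶠ t : ℝ in 𝓝[>] 0, 0 < t := eventually_mem_nhdsWithin
  have hz := tendsto_add_smul_nhds (z₀ := z₀) ht0 hd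
  have hq := tendsto_second_quotient hs.contDiffAt hpos ht0 hd
  simp only [hs.map_eq_zero, sub_zero] at hq
  have hq2 := (hq.add_const ((1 / 2 : ℝ) • (A u - D))).norm
  have e1 : ‖(1 / 2 : ℝ) • b + (1 / 2 : ℝ) • (A u - D)‖ = N / 2 := by
    rw [← smul_add, norm_smul, hN, show b + (A u - D) = A u + b - D by abel]
    norm_num
    ring
  rw [e1] at hq2
  have h3 : ∀ᶠ t : ℝ in 𝓝[>] 0, ‖t • A v + (t ^ 2 / 2) • D‖ < r :=
    (tendsto_nhdsGT_zero_of_continuous (f := fun t : ℝ => ‖t • A v + (t ^ 2 / 2) • D‖)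
      (by fun_prop) (y := 0) (by simp)).eventually_lt_const hs.pos
  have h4 : ∀ᶠ t : ℝ in 𝓝[>] 0, t * σ / 2 < 1 :=
    (tendsto_nhdsGT_zero_of_continuous (f := fun t : ℝ => t * σ / 2)
      (by fun_prop) (y := 0) (by simp)).eventually_lt_const one_pos
  filter_upwards [hpos, hz.eventually hs.subregular,
    hq2.eventually_lt_const (by linarith : N / 2 < N / 2 + δ), h3, h4] with t ht h1 h2 h3 h4
  -- The arc `z₀ + t v + (t²/2) u` is corrected towards this element of `K`. It matches `G` along
  -- the arc to first order and leaves a residual of norm about `t² N / 2`.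
  have hkK : t • A v + (t ^ 2 / 2) • D ∈ K := by
    have : t • A v + (t ^ 2 / 2) • D =
        (t ^ 2 / 2) • k + (t * (1 - t * σ / 2)) • A v := by rw [hD]; module
    rw [this]
    exact K.add_mem (K.smul_mem hk (by positivity))
      (K.smul_mem hsys.map_mem (mul_nonneg ht.le (by linarith)))
  obtain ⟨z, hzΩ, hzn⟩ := h1 _ hkK h3
  have h5 : ‖G (z₀ + t • (v + (t / 2) • u)) - (t • A v + (t ^ 2 / 2) • D)‖ ≤
      t ^ 2 * (N / 2 + δ) := by
    have e2 : G (z₀ + t • (v + (t / 2) • u)) - (t • A v + (t ^ 2 / 2) • D) = t ^ 2 •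
        ((t ^ 2)⁻¹ • (G (z₀ + t • (v + (t / 2) • u)) - t • A (v + (t / 2) • u)) +
          (1 / 2 : ℝ) • (A u - D)) := by
      generalize G (z₀ + t • (v + (t / 2) • u)) = y
      rw [smul_add (t ^ 2), smul_inv_smul₀ (pow_pos ht 2).ne', map_add, map_smul]
      module
    rw [e2, norm_smul, Real.norm_of_nonneg (by positivity)]
    gcongr
  have h6 : ‖z - (z₀ + t • (v + (t / 2) • u))‖ ≤ t ^ 2 * (κ * (N / 2 + δ)) :=
    hzn.trans ((mul_le_mul_of_nonneg_left h5 hκ).trans_eq (by ring))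
  refine ⟨z, hzΩ, ?_, ?_⟩
  · have e3 : z - z₀ - t • v = (z - (z₀ + t • (v + (t / 2) • u))) + (t ^ 2 / 2) • u := by module
    rw [e3]
    refine (norm_add_le _ _).trans ?_
    rw [norm_smul, Real.norm_of_nonneg (by positivity : 0 ≤ t ^ 2 / 2)]
    linarith
  · have e3 : ζ (z - z₀) = ζ (z - (z₀ + t • (v + (t / 2) • u))) + t ^ 2 / 2 * ζ u := by
      have : z - z₀ = (z - (z₀ + t • (v + (t / 2) • u))) + t • v + (t ^ 2 / 2) • u := by module
      rw [this, map_add, map_add, map_smul, map_smul, hsys.critical]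
      simp
    have h7 : -ζ (z - (z₀ + t • (v + (t / 2) • u))) ≤ ‖ζ‖ * (t ^ 2 * (κ * (N / 2 + δ))) :=
      (neg_le_abs _).trans ((ζ.le_opNorm _).trans (by gcongr))
    have h8 : ‖ζ‖ * (t ^ 2 * (κ * (N / 2 + δ))) ≤
        t ^ 2 * (κ * ‖ζ‖ * N / 2 + γ / 2) := by
      have := mul_le_mul_of_nonneg_left hδ1 (sq_nonneg t)
      linarith
    rw [e3, neg_add]
    calc _ ≤ t ^ 2 * (κ * ‖ζ‖ * N / 2 + γ / 2) + -(t ^ 2 / 2 * ζ u) := by linarith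
      _ = _ := by rw [hγ]; ring

/-- The product `P × X` carries the maximum norm, so the smooth quadratic penalty has to be pulled
back from a Euclidean space. -/
theorem exists_clm_euclidean_norm_le (Z : Type*) [NormedAddCommGroup Z] [NormedSpace ℝ Z]
    [FiniteDimensional ℝ Z] :
    ∃ T : Z →L[ℝ] EuclideanSpace ℝ (Fin (Module.finrank ℝ Z)), ∀ w, ‖w‖ ≤ ‖T w‖ := by
  let L : Z ≃L[ℝ] EuclideanSpace ℝ (Fin (Module.finrank ℝ Z)) := toEuclidean
  set N := ‖(L.symm : EuclideanSpace ℝ (Fin (Module.finrank ℝ Z)) →L[ℝ] Z)‖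
  refine ⟨N • (L : Z →L[ℝ] EuclideanSpace ℝ (Fin (Module.finrank ℝ Z))), fun w => ?_⟩
  have h := (L.symm : EuclideanSpace ℝ (Fin (Module.finrank ℝ Z)) →L[ℝ] Z).le_opNorm (L w)
  rw [ContinuousLinearEquiv.coe_coe, L.symm_apply_apply] at h
  rwa [_root_.smul_apply, norm_smul, Real.norm_of_nonneg (norm_nonneg _)]

/-- Local minimizers of a linear functional with a quadratic penalty produce regular normals. -/
theorem mem_regularNormalCone_of_isMinOn {F : Type*} [NormedAddCommGroup F]
    [InnerProductSpace ℝ F] {T : Z →L[ℝ] F} {ξ : StrongDual ℝ Z} {ρ : ℝ} {a z : Z} (hρ : 0 ≤ ρ)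
    (hz : z ∈ Ω) (hmin : ∀ᶠ y in 𝓝[Ω] z,
      -ξ z + ρ / 2 * ‖T (z - a)‖ ^ 2 ≤ -ξ y + ρ / 2 * ‖T (y - a)‖ ^ 2) :
    ξ - ρ • (innerSL ℝ (T (z - a))).comp T ∈ regularNormalCone Ω z := by
  refine mem_regularNormalCone_of_quadratic_bound (c := ρ / 2 * ‖T‖ ^ 2) hz ?_
  filter_upwards [hmin] with y hy
  have h1 : T (y - a) = T (z - a) + T (y - z) := by rw [← map_add]; congr 1; abel
  have h2 : ‖T (y - z)‖ ≤ ‖T‖ * ‖y - z‖ := T.le_opNorm _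
  have h3 : ‖T (y - z)‖ ^ 2 ≤ ‖T‖ ^ 2 * ‖y - z‖ ^ 2 := by rw [← mul_pow]; gcongr
  rw [h1, norm_add_sq_real] at hy
  simp only [_root_.sub_apply, _root_.smul_apply, ContinuousLinearMap.comp_apply,
    innerSL_apply_apply, smul_eq_mul]
  rw [map_sub ξ]
  have h4 := mul_le_mul_of_nonneg_left h3 (by positivity : 0 ≤ ρ / 2)
  linarith

/-- Turns the growth estimate for the minimizers into a bound linear in `t`. -/
theorem norm_le_of_sq_le {x t a b : ℝ} (ht : 0 < t) (ha : 0 ≤ a) (hb : 0 ≤ b)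
    (h : x ^ 2 ≤ t * a * x + b * t ^ 2) : x ≤ (a + b + 1) * t := by
  by_contra! hx
  have h1 : t ≤ x := by nlinarith [mul_nonneg (add_nonneg ha hb) ht.le]
  have h2 : (a + b + 1) * t * x < x * x := by
    apply mul_lt_mul_of_pos_right hx
    linarith
  nlinarith [mul_le_mul_of_nonneg_left h1 (mul_nonneg hb ht.le), mul_pos ht (ht.trans_le h1)]

/-- Near `z₀` the set is compact, and its points satisfy a quadratic growth estimate. -/
theorem ReducedSystem.exists_compact_growth [FiniteDimensional ℝ Z]
    (hs : ReducedSystem G Ω K κ r z₀) (μ : StrongDual ℝ E) (hμ : ∀ k ∈ K, μ k ≤ 0) :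
    ∃ R : ℝ, 0 < R ∧ IsCompact (Ω ∩ Metric.closedBall z₀ R) ∧
      ∀ z ∈ Ω ∩ Metric.closedBall z₀ R, G z ∈ K ∧
        μ (fderiv ℝ G z₀ (z - z₀)) ≤ ‖μ‖ * (‖hess G z₀‖ / 2 + 1) * ‖z - z₀‖ ^ 2 := by
  have : ProperSpace Z := FiniteDimensional.proper_real Z
  have hsub : Tendsto (fun z => z - z₀) (𝓝 z₀) (𝓝 0) := by
    simpa using (by fun_prop : Continuous fun z => z - z₀).tendsto z₀
  have hT := hsub.eventually ((isLittleO_taylor_two hs.contDiffAt).def one_pos)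
  obtain ⟨R, hR, hball⟩ := Metric.nhds_basis_closedBall.eventually_iff.1
    (hs.mem_iff.and (hs.eventually_differentiableAt.and hT))
  refine ⟨R, hR, ?_, ?_⟩
  · have hcont : ContinuousOn G (Metric.closedBall z₀ R) := fun z hz =>
      (hball hz).2.1.continuousAt.continuousWithinAt
    have : Ω ∩ Metric.closedBall z₀ R = Metric.closedBall z₀ R ∩ G ⁻¹' K := by
      ext z
      constructor
      · rintro ⟨h1, h2⟩
        exact ⟨h2, (hball h2).1.1 h1⟩
      · rintro ⟨h1, h2⟩
        exact ⟨(hball h1).1.2 h2, h1⟩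
    rw [this]
    exact (isCompact_closedBall z₀ R).of_isClosed_subset
      (hcont.preimage_isClosed_of_isClosed Metric.isClosed_closedBall K.isClosed) inter_subset_left
  · rintro z ⟨hz, hzR⟩
    obtain ⟨h1, -, h2⟩ := hball hzR
    have hzK := h1.1 hz
    refine ⟨hzK, ?_⟩
    rw [add_sub_cancel, hs.map_eq_zero, sub_zero, norm_pow, norm_norm, one_mul] at h2
    set w := z - z₀
    set R' := G z - fderiv ℝ G z₀ w - (1 / 2 : ℝ) • hess G z₀ w w with hR'
    have e : fderiv ℝ G z₀ w = G z - R' - (1 / 2 : ℝ) • hess G z₀ w w := by rw [hR']; abel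
    have h3 : -μ R' ≤ ‖μ‖ * ‖w‖ ^ 2 :=
      (neg_le_abs _).trans ((μ.le_opNorm _).trans (by gcongr))
    have h4 : -μ (hess G z₀ w w) ≤ ‖μ‖ * (‖hess G z₀‖ * ‖w‖ * ‖w‖) :=
      (neg_le_abs _).trans ((μ.le_opNorm _).trans (by gcongr; exact (hess G z₀).le_opNorm₂ w w))
    rw [e, map_sub, map_sub, map_smul, smul_eq_mul]
    have := hμ _ hzK
    nlinarith

/-- The minimizer `z₀ + t d` of the penalized functional carries the regular normal `ζ + t (v* - ρ
T^*T(d - v))`, so it suffices to show `d → v`. The directions `d` are bounded by comparison with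
`z₀`; a cluster point `e` is identified with `v` by comparison with a nearly optimal arc. -/
theorem ReducedSystem.mem_tangentCone_gph [FiniteDimensional ℝ Z]
    (hs : ReducedSystem G Ω K κ r z₀) {ζ ω : StrongDual ℝ Z} {v : Z} {μ : StrongDual ℝ E}
    (hsys : SecondOrderSystem (fderiv ℝ G z₀) (hess G z₀ v v) K ζ v μ ω) :
    (v, μ.comp (hess G z₀ v) + ω) ∈ tangentCone (gph (normalCone Ω)) (z₀, ζ) := by
  have : ProperSpace Z := FiniteDimensional.proper_real Z
  obtain ⟨hμ, hμζ⟩ := hsys.mem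
  set A := fderiv ℝ G z₀ with hA
  set H := hess G z₀ with hH
  set vs : StrongDual ℝ Z := μ.comp (H v) + ω with hvs
  have hζA : ∀ w, ζ w = μ (A w) := fun w => by rw [← hμζ]; rfl
  obtain ⟨T, hT⟩ := exists_clm_euclidean_norm_le Z
  set M := ‖μ‖ * (‖H‖ / 2 + 1) with hM
  have hM0 : 0 ≤ M := by positivity
  -- Large enough to dominate both the growth `ζ(z - z₀) ≤ M‖z - z₀‖²` on `Ω` and the curvature term
  -- `μ(H(e - v)(e - v))`.
  set ρ := 4 * (M + 1) with hρ
  have hρ0 : 0 ≤ ρ := by positivity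
  obtain ⟨R, hR, hcomp, hgrow⟩ := hs.exists_compact_growth μ hμ
  let t : ℕ → ℝ := fun n => 1 / ((n : ℝ) + 1)
  have ht : ∀ n, 0 < t n := fun n => by positivity
  have ht0 : Tendsto t atTop (𝓝 0) := tendsto_one_div_add_atTop_nhds_zero_nat
  let Φ : ℝ → Z → ℝ := fun s z => -(ζ + s • vs) z + ρ / 2 * ‖T (z - (z₀ + s • v))‖ ^ 2
  have hex : ∀ s, ∃ z ∈ Ω ∩ Metric.closedBall z₀ R, ∀ y ∈ Ω ∩ Metric.closedBall z₀ R,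
      Φ s z ≤ Φ s y := fun s =>
    hcomp.exists_isMinOn (f := Φ s) ⟨z₀, hs.mem, by simp [hR.le]⟩
      (by fun_prop : Continuous (Φ s)).continuousOn
  choose zz hzz hmin using hex
  obtain ⟨d, hzd⟩ : ∃ d : ℕ → Z, ∀ n, z₀ + t n • d n = zz (t n) :=
    ⟨fun n => (t n)⁻¹ • (zz (t n) - z₀), fun n => by
      rw [smul_inv_smul₀ (ht n).ne', add_sub_cancel]⟩
  have hΦ : ∀ (s : ℝ) (w : Z), Φ s (z₀ + w) = -(ζ + s • vs) z₀ - ζ w - s * vs w +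
      ρ / 2 * ‖T (w - s • v)‖ ^ 2 := fun s w => by
    simp only [Φ, map_add, _root_.add_apply, _root_.smul_apply, smul_eq_mul]
    rw [show z₀ + w - (z₀ + s • v) = w - s • v by abel]
    ring
  have hbase : ∀ n, -ζ (t n • d n) - t n * vs (t n • d n) +
      ρ / 2 * ‖T (t n • d n - t n • v)‖ ^ 2 ≤ ρ / 2 * (t n ^ 2 * ‖T v‖ ^ 2) := fun n => by
    have h1 := hmin (t n) z₀ ⟨hs.mem, by simp [hR.le]⟩
    have h2 := hΦ (t n) (t n • d n)
    have h3 := hΦ (t n) 0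
    rw [hzd] at h2
    rw [add_zero, zero_sub, map_neg, norm_neg, map_smul T, norm_smul,
      Real.norm_of_nonneg (ht n).le, mul_pow] at h3
    simp only [map_zero, mul_zero, sub_zero] at h3
    linarith
  have hKz : ∀ n, G (z₀ + t n • d n) ∈ K := fun n => by
    rw [hzd]; exact (hgrow _ (hzz _)).1
  set C := ‖vs‖ + ρ * ‖T v‖ ^ 2 + 1 with hC
  have hdC : ∀ n, d n ∈ Metric.closedBall (0 : Z) C := fun n => by
    rw [mem_closedBall_zero_iff]
    set w := t n • d n with hw
    have h1 := hbase n
    rw [← hw] at h1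
    have h2 : ζ w ≤ M * ‖w‖ ^ 2 := by
      have := (hgrow _ (hzz (t n))).2
      rw [← hzd, add_sub_cancel_left] at this
      rw [hζA]
      exact this
    have h3 : vs w ≤ ‖vs‖ * ‖w‖ := (le_abs_self _).trans (vs.le_opNorm _)
    have h4 : ‖w‖ ^ 2 ≤ 2 * ‖T (w - t n • v)‖ ^ 2 + 2 * (t n ^ 2 * ‖T v‖ ^ 2) := by
      have e : T w = T (w - t n • v) + t n • T v := by simp
      have h5 : ‖T w‖ ≤ ‖T (w - t n • v)‖ + t n * ‖T v‖ := by
        rw [e]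
        refine (norm_add_le _ _).trans ?_
        rw [norm_smul, Real.norm_of_nonneg (ht n).le]
      have h6 : ‖w‖ ≤ ‖T (w - t n • v)‖ + t n * ‖T v‖ := (hT w).trans h5
      have h7 : ‖w‖ ^ 2 ≤ (‖T (w - t n • v)‖ + t n * ‖T v‖) ^ 2 := by gcongr
      nlinarith [sq_nonneg (‖T (w - t n • v)‖ - t n * ‖T v‖)]
    have h5 : ‖w‖ ^ 2 ≤ t n * ‖vs‖ * ‖w‖ + ρ * ‖T v‖ ^ 2 * t n ^ 2 := by
      have h6 := mul_le_mul_of_nonneg_left h4 (by positivity : 0 ≤ ρ / 4)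
      have h7 := mul_le_mul_of_nonneg_left h3 (ht n).le
      have h8 : ρ / 4 * ‖w‖ ^ 2 = M * ‖w‖ ^ 2 + ‖w‖ ^ 2 := by rw [hρ]; ring
      linarith
    have h6 := norm_le_of_sq_le (ht n) (norm_nonneg vs) (by positivity) h5
    rw [hw, norm_smul, Real.norm_of_nonneg (ht n).le, mul_comm] at h6
    exact le_of_mul_le_mul_right h6 (ht n)
  obtain ⟨e, -, φ, hφ, hlim⟩ := (isCompact_closedBall (0 : Z) C).tendsto_subseq hdC
  have hφ' := hφ.tendsto_atTop
  have htφ : Tendsto (fun n => t (φ n)) atTop (𝓝 0) := ht0.comp hφ'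
  have hzlim : Tendsto (fun n => z₀ + t (φ n) • d (φ n)) atTop (𝓝 z₀) :=
    tendsto_add_smul_nhds htφ hlim
  have hAe : A e ∈ K := map_fderiv_mem_of_tendsto hs.contDiffAt hs.map_eq_zero
    (fun n => ht (φ n)) htφ hlim (Eventually.of_forall fun n => hKz (φ n))
  -- Feasibility gives `ζ e = μ(A e) ≤ 0`; the comparison with `z₀`, divided by `t`, gives the
  -- opposite sign.
  have hζe : ζ e = 0 := by
    refine le_antisymm ((hζA e).trans_le (hμ _ hAe)) ?_
    have h1 : Tendsto (fun n => ζ (d (φ n)) + t (φ n) * (vs (d (φ n)) + ρ / 2 * ‖T v‖ ^ 2)) atTop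
        (𝓝 (ζ e + 0 * (vs e + ρ / 2 * ‖T v‖ ^ 2))) :=
      ((ζ.continuous.tendsto e).comp hlim).add
        (htφ.mul (((vs.continuous.tendsto e).comp hlim).add_const _))
    rw [zero_mul, add_zero] at h1
    refine ge_of_tendsto' h1 fun n => ?_
    have h2 := hbase (φ n)
    have htn := ht (φ n)
    rw [map_smul, map_smul, smul_eq_mul, smul_eq_mul] at h2
    have h3 : 0 ≤ ρ / 2 * ‖T (t (φ n) • d (φ n) - t (φ n) • v)‖ ^ 2 := by positivity
    have h4 : 0 ≤ t (φ n) * (ζ (d (φ n)) + t (φ n) * (vs (d (φ n)) + ρ / 2 * ‖T v‖ ^ 2)) := by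
      linarith
    exact nonneg_of_mul_nonneg_right h4 htn
  have hq := tendsto_second_quotient hs.contDiffAt
    (Eventually.of_forall fun n => ht (φ n)) htφ hlim
  simp only [hs.map_eq_zero, sub_zero] at hq
  -- The minimizers are compared with the arc, the inequality is divided by `t²`, and `μ(G z) ≤ 0`
  -- replaces the first-order term `-ζ(d)/t` by a lower bound tending to `μ(H e e)/2`.
  have hval : ∀ ε : ℝ, 0 < ε → μ (H e e) / 2 - vs e + ρ / 2 * ‖T (e - v)‖ ^ 2 ≤
      (μ (H v v) + ε) / 2 - vs v := by
    intro ε hε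
    obtain ⟨c, hc, harc⟩ := hs.exists_nearly_optimal_arc hsys hε
    have htw : Tendsto (fun n => t (φ n)) atTop (𝓝[>] 0) :=
      tendsto_nhdsWithin_iff.2 ⟨htφ, Eventually.of_forall fun n => ht (φ n)⟩
    have hlhs : Tendsto (fun n => μ ((t (φ n) ^ 2)⁻¹ •
        (G (z₀ + t (φ n) • d (φ n)) - t (φ n) • A (d (φ n)))) - vs (d (φ n)) +
        ρ / 2 * ‖T (d (φ n) - v)‖ ^ 2) atTop
        (𝓝 (μ ((1 / 2 : ℝ) • H e e) - vs e + ρ / 2 * ‖T (e - v)‖ ^ 2)) :=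
      (((μ.continuous.tendsto _).comp hq).sub ((vs.continuous.tendsto e).comp hlim)).add
        (((by fun_prop : Continuous fun x => ρ / 2 * ‖T (x - v)‖ ^ 2).tendsto e).comp hlim)
    have hrhs : Tendsto (fun n => (μ (H v v) + ε) / 2 - vs v + (t (φ n) * (‖vs‖ * c) +
        t (φ n) ^ 2 * (ρ / 2 * (‖T‖ * c) ^ 2))) atTop
        (𝓝 ((μ (H v v) + ε) / 2 - vs v + (0 * (‖vs‖ * c) + 0 ^ 2 * (ρ / 2 * (‖T‖ * c) ^ 2)))) :=
      tendsto_const_nhds.add ((htφ.mul_const _).add ((htφ.pow 2).mul_const _))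
    have hsmall : ∀ᶠ s : ℝ in 𝓝[>] 0, s * ‖v‖ + c * s ^ 2 < R :=
      (tendsto_nhdsGT_zero_of_continuous (f := fun s : ℝ => s * ‖v‖ + c * s ^ 2)
        (by fun_prop) (y := 0) (by simp)).eventually_lt_const hR
    have hle := le_of_tendsto_of_tendsto hlhs hrhs (by
      filter_upwards [htw.eventually harc, htw.eventually hsmall] with n h1 h2
      obtain ⟨y, hyΩ, hyn, hyζ⟩ := h1
      set s := t (φ n) with hs'
      have hspos : 0 < s := ht (φ n)
      have hyR : ‖y - z₀‖ ≤ R := by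
        have e1 : y - z₀ = (y - z₀ - s • v) + s • v := by abel
        rw [e1]
        refine (norm_add_le _ _).trans ?_
        rw [norm_smul, Real.norm_of_nonneg hspos.le]
        linarith
      have h3 := hmin s y ⟨hyΩ, by rwa [Metric.mem_closedBall, dist_eq_norm]⟩
      have h4 := hΦ s (y - z₀)
      have h5 := hΦ s (s • d (φ n))
      rw [add_sub_cancel] at h4
      rw [hzd] at h5
      have h6 : -vs (y - z₀) ≤ -(s * vs v) + ‖vs‖ * (c * s ^ 2) := by
        have e1 : vs (y - z₀) = vs (y - z₀ - s • v) + s * vs v := by simp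
        have : -vs (y - z₀ - s • v) ≤ ‖vs‖ * (c * s ^ 2) :=
          (neg_le_abs _).trans ((vs.le_opNorm _).trans (by gcongr))
        linarith
      have h7 : ‖T (y - z₀ - s • v)‖ ^ 2 ≤ (‖T‖ * (c * s ^ 2)) ^ 2 := by
        have := (T.le_opNorm (y - z₀ - s • v)).trans
          (mul_le_mul_of_nonneg_left hyn (norm_nonneg T))
        gcongr
      have h8 : T (s • d (φ n) - s • v) = s • T (d (φ n) - v) := by
        rw [← smul_sub, map_smul]
      rw [h8, norm_smul, Real.norm_of_nonneg hspos.le, mul_pow, map_smul, map_smul, smul_eq_mul,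
        smul_eq_mul] at h5
      have h9 := hμ _ (hKz (φ n))
      have h10 : μ ((s ^ 2)⁻¹ • (G (z₀ + s • d (φ n)) - s • A (d (φ n)))) =
          (s ^ 2)⁻¹ * (μ (G (z₀ + s • d (φ n))) - s * ζ (d (φ n))) := by
        rw [map_smul, map_sub, map_smul, hζA, smul_eq_mul, smul_eq_mul]
      rw [h10]
      have h11 : (s ^ 2)⁻¹ * (μ (G (z₀ + s • d (φ n))) - s * ζ (d (φ n))) ≤
          (s ^ 2)⁻¹ * (-(s * ζ (d (φ n)))) := by
        gcongr
        linarith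
      have h12 : -(s * ζ (d (φ n))) - s * (s * vs (d (φ n))) +
          ρ / 2 * (s ^ 2 * ‖T (d (φ n) - v)‖ ^ 2) ≤
          s ^ 2 * ((μ (H v v) + ε) / 2) + s * (-(s * vs v) + ‖vs‖ * (c * s ^ 2)) +
          ρ / 2 * (‖T‖ * (c * s ^ 2)) ^ 2 := by
        have := mul_le_mul_of_nonneg_left h6 hspos.le
        have := mul_le_mul_of_nonneg_left h7 (by positivity : 0 ≤ ρ / 2)
        linarith
      have h13 := mul_le_mul_of_nonneg_left h12 (by positivity : 0 ≤ (s ^ 2)⁻¹)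
      have h14 : (s ^ 2)⁻¹ * (-(s * ζ (d (φ n))) - s * (s * vs (d (φ n))) +
          ρ / 2 * (s ^ 2 * ‖T (d (φ n) - v)‖ ^ 2)) = (s ^ 2)⁻¹ * (-(s * ζ (d (φ n)))) -
          vs (d (φ n)) + ρ / 2 * ‖T (d (φ n) - v)‖ ^ 2 := by
        field_simp
      have h15 : (s ^ 2)⁻¹ * (s ^ 2 * ((μ (H v v) + ε) / 2) +
          s * (-(s * vs v) + ‖vs‖ * (c * s ^ 2)) + ρ / 2 * (‖T‖ * (c * s ^ 2)) ^ 2) =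
          (μ (H v v) + ε) / 2 - vs v + (s * (‖vs‖ * c) + s ^ 2 * (ρ / 2 * (‖T‖ * c) ^ 2)) := by
        field_simp
        ring
      linarith)
    rw [map_smul, smul_eq_mul] at hle
    linarith
  -- Since `v* = μ ∘ H v + ω` with `ω e ≤ 0 = ω v`, completing the square leaves `μ(H(e - v)(e -
  -- v))/2 + (ρ/2)‖T(e - v)‖² ≤ 0`, and the choice of `ρ` forces `e = v`.
  have hev : e = v := by
    have h1 : μ (H e e) / 2 - vs e + ρ / 2 * ‖T (e - v)‖ ^ 2 ≤ μ (H v v) / 2 - vs v := by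
      refine le_of_forall_pos_le_add fun ε hε => ?_
      have := hval ε hε
      linarith
    have hsymm : μ (H v e) = μ (H e v) :=
      congrArg μ ((hs.contDiffAt.isSymmSndFDerivAt (by simp)).eq v e)
    have h2 : μ (H (e - v) (e - v)) = μ (H e e) - 2 * μ (H v e) + μ (H v v) := by
      simp only [map_sub, _root_.sub_apply]
      linarith
    have h3 : vs e - vs v = μ (H v e) - μ (H v v) + ω e := by
      simp only [hvs, _root_.add_apply, ContinuousLinearMap.comp_apply, hsys.orth]
      ring
    have h4 := hsys.polar e hAe hζe
    have h5 : -μ (H (e - v) (e - v)) ≤ ‖μ‖ * (‖H‖ * ‖e - v‖ * ‖e - v‖) :=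
      (neg_le_abs _).trans ((μ.le_opNorm _).trans (by gcongr; exact H.le_opNorm₂ _ _))
    have h6 : ‖e - v‖ ^ 2 ≤ ‖T (e - v)‖ ^ 2 := by
      have := hT (e - v)
      gcongr
    have h7 := mul_le_mul_of_nonneg_left h6 (by positivity : 0 ≤ ρ / 2)
    have h8 : ρ / 2 * ‖e - v‖ ^ 2 = ‖μ‖ * (‖H‖ * ‖e - v‖ * ‖e - v‖) + 2 * ‖μ‖ * ‖e - v‖ ^ 2 +
        2 * ‖e - v‖ ^ 2 := by rw [hρ, hM]; ring
    have h9 : 0 ≤ ‖μ‖ * (‖H‖ * ‖e - v‖ * ‖e - v‖) := by positivity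
    have h10 : 0 ≤ 2 * ‖μ‖ * ‖e - v‖ ^ 2 := by positivity
    have h11 : ‖e - v‖ ^ 2 ≤ 0 := by linarith
    exact sub_eq_zero.1 (norm_eq_zero.1 (pow_eq_zero_iff two_ne_zero |>.1
      (le_antisymm h11 (sq_nonneg _))))
  rw [hev] at hlim
  let xs : ℕ → StrongDual ℝ Z := fun n =>
    vs - ρ • (innerSL ℝ (T (d (φ n) - v))).comp T
  have hxs : Tendsto xs atTop (𝓝 vs) := by
    have : Tendsto xs atTop (𝓝 (vs - ρ • (innerSL ℝ (T (v - v))).comp T)) :=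
      ((by fun_prop : Continuous fun x => vs - ρ • (innerSL ℝ (T (x - v))).comp T).tendsto v).comp
        hlim
    simpa using this
  have hnormal : ∀ᶠ n in atTop, ζ + t (φ n) • xs n ∈ normalCone Ω (z₀ + t (φ n) • d (φ n)) := by
    filter_upwards [hzlim.eventually (Metric.ball_mem_nhds z₀ hR)] with n hn
    refine regularNormalCone_subset_normalCone _ _ ?_
    rw [hzd] at hn ⊢
    have h1 := mem_regularNormalCone_of_isMinOn (T := T) (ξ := ζ + t (φ n) • vs)
      (a := z₀ + t (φ n) • v) hρ0 (hzz (t (φ n))).1 (by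
        filter_upwards [self_mem_nhdsWithin, mem_nhdsWithin_of_mem_nhds
          (Metric.isOpen_ball.mem_nhds hn)] with y hy hy'
        exact hmin (t (φ n)) y ⟨hy, Metric.ball_subset_closedBall hy'⟩)
    convert h1 using 1
    have : zz (t (φ n)) - (z₀ + t (φ n) • v) = t (φ n) • (d (φ n) - v) := by
      rw [← hzd, smul_sub]
      abel
    ext w
    simp only [xs, this, map_smul, _root_.add_apply, _root_.sub_apply, _root_.smul_apply,
      ContinuousLinearMap.comp_apply, smul_eq_mul]
    ring
  rw [mem_tangentCone_iff]
  intro ε hε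
  have hpair : Tendsto (fun n => ((d (φ n), xs n) : Z × StrongDual ℝ Z)) atTop (𝓝 (v, vs)) :=
    hlim.prodMk_nhds hxs
  obtain ⟨n, h1, h2, h3⟩ := ((htφ.eventually_lt_const hε).and
    ((hpair.eventually (Metric.ball_mem_nhds _ hε)).and hnormal)).exists
  exact ⟨t (φ n), ht _, h1, (d (φ n), xs n), by rwa [dist_eq_norm] at h2, h3⟩

theorem ReducedSystem.mem_tangentCone_gph_iff [FiniteDimensional ℝ Z] [FiniteDimensional ℝ E]
    (hs : ReducedSystem G Ω K κ r z₀) {ζ vs : StrongDual ℝ Z} {v : Z} :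
    (v, vs) ∈ tangentCone (gph (normalCone Ω)) (z₀, ζ) ↔
      ∃ μ ω, SecondOrderSystem (fderiv ℝ G z₀) (hess G z₀ v v) K ζ v μ ω ∧
        vs = μ.comp (hess G z₀ v) + ω := by
  constructor
  · exact hs.exists_of_mem_tangentCone_gph
  · rintro ⟨μ, ω, hsys, rfl⟩
    exact hs.mem_tangentCone_gph hsys

end Sufficiency

/-! ### Parametric systems: projecting normals and lifting them back. -/

section Parametric

variable {E : Type*} [NormedAddCommGroup E] [NormedSpace ℝ E] {K : ProperCone ℝ E}

/-- A polyhedral cone is described by finitely many homogeneous inequalities. -/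
theorem IsPolyhedral.exists_finset_functional (hK : IsPolyhedral (K : Set E)) :
    ∃ s : Finset (StrongDual ℝ E), ∀ e, e ∈ K ↔ ∀ a ∈ s, a e ≤ 0 := by
  classical
  obtain ⟨s, hs⟩ := hK
  have hmem : ∀ e, e ∈ K ↔ ∀ p ∈ s, p.1 e ≤ p.2 := fun e => by
    rw [← SetLike.mem_coe, hs, mem_ofPred_eq]
  refine ⟨s.image Prod.fst, fun e => ?_⟩
  simp only [Finset.forall_mem_image]
  constructor
  · intro he p hp
    refine nonpos_of_forall_mul_le (c := p.2) fun t ht => ?_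
    simpa using (hmem _).1 (K.smul_mem he ht) p hp
  · intro h
    refine (hmem e).2 fun p hp => (h hp).trans ?_
    simpa using (hmem 0).1 K.zero_mem p hp

/-- In Farkas' representation of `μ` all terms are nonpositive at `y` and sum to zero, so inactive
functionals get coefficient zero. -/
theorem exists_active_nonneg_combination [FiniteDimensional ℝ E] {s : Finset (StrongDual ℝ E)}
    (hK : ∀ e, e ∈ K ↔ ∀ a ∈ s, a e ≤ 0) {μ : StrongDual ℝ E} (hμ : ∀ k ∈ K, μ k ≤ 0) {y : E}
    (hy : y ∈ K) (hμy : μ y = 0) :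
    ∃ c : s → ℝ, (∀ i, 0 ≤ c i) ∧ (∀ i, i.1 y ≠ 0 → c i = 0) ∧ ∑ i, c i • i.1 = μ := by
  obtain ⟨c, hc, hsum⟩ := exists_nonneg_combination_of_polar (fun i : s => i.1) μ
    fun e he => hμ e ((hK e).2 fun a ha => he ⟨a, ha⟩)
  refine ⟨c, hc, fun i hi => ?_, hsum⟩
  have h1 : ∑ i, c i * i.1 y = 0 := by
    rw [← hμy, ← hsum]
    simp
  have h2 := (Finset.sum_eq_zero_iff_of_nonpos fun i _ =>
    mul_nonpos_of_nonneg_of_nonpos (hc i) ((hK y).1 hy _ i.2)).1 h1 i (Finset.mem_univ i)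
  exact (mul_eq_zero.1 h2).resolve_right hi

theorem exists_tendsto_of_pointwise {F : Type*} [NormedAddCommGroup F] [NormedSpace ℝ F]
    [FiniteDimensional ℝ F] {L : ℕ → StrongDual ℝ F}
    (h : ∀ w, ∃ c : ℝ, Tendsto (fun j => L j w) atTop (𝓝 c)) :
    ∃ L₀ : StrongDual ℝ F, Tendsto L atTop (𝓝 L₀) := by
  choose c hc using h
  let b := Module.finBasis ℝ F
  let coord : Fin (Module.finrank ℝ F) → StrongDual ℝ F := fun i =>
    LinearMap.toContinuousLinearMap (b.coord i)
  refine ⟨∑ i, c (b i) • coord i, ?_⟩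
  have : ∀ j, ∑ i, L j (b i) • coord i = L j := fun j => by
    ext w
    have := congrArg (L j) (b.sum_repr w)
    simp only [map_sum, map_smul, smul_eq_mul] at this
    refine Eq.trans ?_ this
    simp [coord, mul_comm]
  refine Tendsto.congr this ?_
  exact tendsto_finsetSum _ fun i _ => (hc (b i)).smul_const _

variable {P X : Type*} [NormedAddCommGroup P] [NormedSpace ℝ P] [NormedAddCommGroup X]
  [NormedSpace ℝ X]

/-- A parametric constraint `G (p, x) ∈ K` with solution map `Γ`, satisfying a metric estimate in
`x` that is uniform in the parameter. -/
structure ParametricSystem (G : P × X → E) (Γ : P → Set X) (K : ProperCone ℝ E) (κ r : ℝ)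
    (z₀ : P × X) : Prop where
  contDiffAt : ContDiffAt ℝ 2 G z₀
  map_eq_zero : G z₀ = 0
  mem_iff : ∀ᶠ z in 𝓝 z₀, (z.2 ∈ Γ z.1 ↔ G z ∈ K)
  nonneg : 0 ≤ κ
  pos : 0 < r
  stable : ∀ᶠ z in 𝓝 z₀, ∀ k ∈ K, ‖k‖ < r → ∃ x ∈ Γ z.1, ‖x - z.2‖ ≤ κ * ‖G z - k‖

variable {G : P × X → E} {Γ : P → Set X} {κ r : ℝ} {z₀ : P × X}

theorem ParametricSystem.reducedSystem (hs : ParametricSystem G Γ K κ r z₀) :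
    ReducedSystem G (gph Γ) K κ r z₀ where
  contDiffAt := hs.contDiffAt
  map_eq_zero := hs.map_eq_zero
  mem_iff := hs.mem_iff
  nonneg := hs.nonneg
  pos := hs.pos
  subregular := by
    filter_upwards [hs.stable] with z hz k hk hkr
    obtain ⟨x, hx, hn⟩ := hz k hk hkr
    refine ⟨(z.1, x), hx, ?_⟩
    rw [Prod.norm_def]
    simpa using hn

theorem hasFDerivAt_partial {z : P × X} (h : DifferentiableAt ℝ G z) :
    HasFDerivAt (fun x => G (z.1, x))
      ((fderiv ℝ G z).comp (ContinuousLinearMap.inr ℝ P X)) z.2 :=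
  HasFDerivAt.comp (g := G) z.2 h.hasFDerivAt (hasFDerivAt_prodMk_right z.1 z.2)

theorem tendsto_prodMk_right {P X : Type*} [TopologicalSpace P] [TopologicalSpace X] (z : P × X) : Tendsto (fun x => (z.1, x)) (𝓝 z.2) (𝓝 z) :=
  (Continuous.prodMk_right z.1).tendsto z.2

theorem ParametricSystem.eventually_exists_multiplier [FiniteDimensional ℝ E]
    (hs : ParametricSystem G Γ K κ r z₀) : ∀ᶠ z in 𝓝 z₀, ∀ ξ ∈ normalCone (Γ z.1) z.2,
      G z ∈ K ∧ ∃ μ : StrongDual ℝ E, ‖μ‖ ≤ κ * ‖ξ‖ ∧ projX (μ.comp (fderiv ℝ G z)) = ξ ∧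
        (∀ k ∈ K, μ k ≤ 0) ∧ μ (G z) = 0 := by
  have h1 : ∀ᶠ z in 𝓝 z₀, ‖G z‖ < r := by
    have := hs.contDiffAt.continuousAt.tendsto.norm
    rw [hs.map_eq_zero, norm_zero] at this
    exact this.eventually_lt_const hs.pos
  filter_upwards [h1, eventually_eventually_nhds.2 hs.mem_iff,
    eventually_eventually_nhds.2 hs.stable, hs.contDiffAt.eventually (by simp)]
    with z h1 h2 h3 h4 ξ hξ
  have hcd : ContDiffAt ℝ 1 (fun x => G (z.1, x)) z.2 :=
    ContDiffAt.comp (g := G) z.2 (h4.of_le (by norm_num))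
      (contDiffAt_const.prodMk contDiffAt_id)
  have hfd := (hasFDerivAt_partial (h4.differentiableAt two_ne_zero)).fderiv
  have hr := tendsto_prodMk_right z
  refine ⟨h2.self_of_nhds.1 hξ.1, ?_⟩
  obtain ⟨μ, h5, h6, h7, h8⟩ := exists_multiplier_of_mem_normalCone hcd (S := Γ z.1) (K := K)
    (κ := κ) (r := r) (by
      filter_upwards [self_mem_nhdsWithin, mem_nhdsWithin_of_mem_nhds (hr.eventually h2)]
        with y hy hy'
      exact hy'.1 hy) h1 hs.nonneg (hr.eventually h3) hξ
  rw [hfd] at h6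
  exact ⟨μ, h5, h6, h7, h8⟩

theorem ParametricSystem.eventually_projX_mem_normalCone (hs : ParametricSystem G Γ K κ r z₀) :
    ∀ᶠ z in 𝓝 z₀, G z ∈ K → ∀ μ : StrongDual ℝ E, (∀ k ∈ K, μ k ≤ 0) → μ (G z) = 0 →
      projX (μ.comp (fderiv ℝ G z)) ∈ normalCone (Γ z.1) z.2 := by
  filter_upwards [eventually_eventually_nhds.2 hs.mem_iff,
    hs.reducedSystem.eventually_differentiableAt] with z h1 h2 hz μ hμ hμz
  refine regularNormalCone_subset_normalCone _ _ (comp_mem_regularNormalCone (S := Γ z.1)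
    (f := fun x => G (z.1, x)) (K := K) (μ := μ) (hasFDerivAt_partial h2)
    (h1.self_of_nhds.2 hz) ?_ hμ hμz)
  filter_upwards [self_mem_nhdsWithin,
    mem_nhdsWithin_of_mem_nhds ((tendsto_prodMk_right z).eventually h1)] with y hy hy'
  exact hy'.1 hy

theorem continuous_projX : Continuous (projX : StrongDual ℝ (P × X) → StrongDual ℝ X) := by
  unfold projX
  fun_prop

theorem projX_add (ζ ξ : StrongDual ℝ (P × X)) : projX (ζ + ξ) = projX ζ + projX ξ := rfl

theorem projX_sub (ζ ξ : StrongDual ℝ (P × X)) : projX (ζ - ξ) = projX ζ - projX ξ := rfl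

theorem projX_smul (c : ℝ) (ζ : StrongDual ℝ (P × X)) : projX (c • ζ) = c • projX ζ := rfl

/-- A multiplier for a normal to `gph Γ` at a nearby point, composed with the partial derivative in
`x`, gives a normal to the slice `Γ(p)`. -/
theorem ParametricSystem.projX_mem_tangentCone [FiniteDimensional ℝ E]
    (hs : ParametricSystem G Γ K κ r z₀) {ζ vs : StrongDual ℝ (P × X)} {v : P × X}
    (h : (v, vs) ∈ tangentCone (gph (normalCone (gph Γ))) (z₀, ζ)) :
    (v, projX vs) ∈ tangentCone (gph fun z : P × X => normalCone (Γ z.1) z.2)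
      (z₀, projX ζ) := by
  obtain ⟨t, p, ht, ht0, hp, hmem⟩ := h
  have hd : Tendsto (fun k => (p k).1) atTop (𝓝 v) := (continuous_fst.tendsto _).comp hp
  have hds : Tendsto (fun k => (p k).2) atTop (𝓝 vs) := (continuous_snd.tendsto _).comp hp
  have hz := tendsto_add_smul_nhds (z₀ := z₀) ht0 hd
  rw [mem_tangentCone_iff]
  intro ε hε
  have hpair := hd.prodMk_nhds ((continuous_projX.tendsto vs).comp hds)
  obtain ⟨n, h1, h2, h3, h4⟩ := ((ht0.eventually_lt_const hε).and
    ((hpair.eventually (Metric.ball_mem_nhds _ hε)).and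
    ((hz.eventually hs.reducedSystem.eventually_exists_multiplier).and
      (hz.eventually hs.eventually_projX_mem_normalCone)))).exists
  refine ⟨t n, ht n, h1, ((p n).1, projX (p n).2), by rwa [dist_eq_norm] at h2, ?_⟩
  obtain ⟨hK, μ, -, h6, h7, h8⟩ := h3 _ (hmem n)
  have h9 := h4 hK μ h7 h8
  rw [h6] at h9
  exact h9

/-- Limits of multipliers under the characteristic subspace condition. -/
theorem exists_tendsto_of_charSubspace [FiniteDimensional ℝ P] [FiniteDimensional ℝ X]
    {A : P × X →L[ℝ] E} {θ : StrongDual ℝ X} {η : ℕ → StrongDual ℝ E}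
    (hA : ∀ q : P, ∃ u : X, ∃ e : E, (∀ j, η j e = 0) ∧ A (q, 0) = A (0, u) + e)
    (hθ : Tendsto (fun j => projX ((η j).comp A)) atTop (𝓝 θ)) :
    ∃ ω, Tendsto (fun j => (η j).comp A) atTop (𝓝 ω) ∧ projX ω = θ := by
  obtain ⟨ω, hω⟩ := exists_tendsto_of_pointwise (L := fun j => (η j).comp A) fun w => by
    obtain ⟨u, e, he, hAe⟩ := hA w.1
    -- The parameter component of `w` is traded for the `x`-direction `u`, up to a vector killed by
    -- every `η j`.
    refine ⟨θ (u + w.2), (tendsto_clm_apply hθ tendsto_const_nhds).congr fun j => ?_⟩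
    have h1 : A w = A (0, u + w.2) + e := by
      have h2 : A w = A (w.1, 0) + A (0, w.2) := by rw [← map_add]; simp
      have h3 : A (0, u + w.2) = A (0, u) + A (0, w.2) := by rw [← map_add]; simp
      rw [h2, h3, hAe]
      abel
    simp [projX, h1, he]
  exact ⟨ω, hω, tendsto_nhds_unique ((continuous_projX.tendsto ω).comp hω) hθ⟩

/-- For a polyhedral cone, limits of projected multiplier quotients are realised by a normal to the
critical cone. -/
theorem exists_secondOrderSystem_of_polyhedral [FiniteDimensional ℝ E]
    {s : Finset (StrongDual ℝ E)} (hK : ∀ e, e ∈ K ↔ ∀ a ∈ s, a e ≤ 0)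
    (hG : ContDiffAt ℝ 2 G z₀) (hG0 : G z₀ = 0) {t : ℕ → ℝ} {d : ℕ → P × X} {v : P × X}
    {m : ℕ → StrongDual ℝ E} {μ : StrongDual ℝ E} {θ : StrongDual ℝ X} (ht : ∀ k, 0 < t k)
    (ht0 : Tendsto t atTop (𝓝 0)) (hd : Tendsto d atTop (𝓝 v)) (hm : Tendsto m atTop (𝓝 μ))
    (hpol : ∀ j, ∀ k ∈ K, m j k ≤ 0) (hcompl : ∀ j, m j (G (z₀ + t j • d j)) = 0)
    (hGK : ∀ j, G (z₀ + t j • d j) ∈ K)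
    (hθ : Tendsto (fun j => (t j)⁻¹ • projX ((m j - μ).comp (fderiv ℝ G z₀))) atTop (𝓝 θ)) :
    ∃ ω, SecondOrderSystem (fderiv ℝ G z₀) (hess G z₀ v v) K (μ.comp (fderiv ℝ G z₀)) v μ ω ∧
      projX ω = θ := by
  classical
  set A := fderiv ℝ G z₀ with hA
  -- There are finitely many active index sets, so one of them, `J`, occurs along a subsequence.
  obtain ⟨J, hJ⟩ : ∃ J : Finset s, ∃ᶠ j in atTop,
      (Finset.univ.filter fun i : s => i.1 (G (z₀ + t j • d j)) = 0) = J := by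
    by_contra! hcon
    obtain ⟨j, hj⟩ := (eventually_all.2 hcon).exists
    exact hj _ rfl
  obtain ⟨φ, hφ, hJφ⟩ := extraction_of_frequently_atTop hJ
  have hφ' := hφ.tendsto_atTop
  have hact : ∀ j, ∀ i : s, i ∈ J ↔ i.1 (G (z₀ + t (φ j) • d (φ j))) = 0 := fun j i => by
    rw [← hJφ j]; simp
  have hcomb : ∀ j, ∃ c : s → ℝ, (∀ i, 0 ≤ c i) ∧ (∀ i, i ∉ J → c i = 0) ∧
      ∑ i, c i • i.1 = m (φ j) := fun j => by
    obtain ⟨c, h1, h2, h3⟩ := exists_active_nonneg_combination hK (hpol (φ j)) (hGK (φ j))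
      (hcompl (φ j))
    exact ⟨c, h1, fun i hi => h2 i fun h => hi ((hact j i).2 h), h3⟩
  choose c hc0 hcJ hcm using hcomb
  have hμ : ∀ k ∈ K, μ k ≤ 0 := fun k hk =>
    le_of_tendsto' (tendsto_clm_apply hm tendsto_const_nhds) fun j => hpol j k hk
  have htφ : Tendsto (fun j => t (φ j)) atTop (𝓝 0) := ht0.comp hφ'
  have hdφ : Tendsto (fun j => d (φ j)) atTop (𝓝 v) := hd.comp hφ'
  have hslope := tendsto_slope_of_hasFDerivAt (hG.differentiableAt two_ne_zero).hasFDerivAt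
    (Eventually.of_forall fun j => ht (φ j)) htφ hdφ
  simp only [hG0, sub_zero] at hslope
  have hAv : A v ∈ K := map_fderiv_mem_of_tendsto hG hG0 (fun j => ht (φ j)) htφ hdφ
    (Eventually.of_forall fun j => hGK (φ j))
  have hvan : ∀ ν : StrongDual ℝ E, (∀ j, ν (G (z₀ + t (φ j) • d (φ j))) = 0) → ν (A v) = 0 :=
    fun ν hν => by
      refine tendsto_nhds_unique ((ν.continuous.tendsto _).comp hslope)
        (tendsto_const_nhds.congr fun j => ?_)
      rw [Function.comp_apply, map_smul, hν, smul_zero]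
  -- `μ` is a limit of combinations of functionals indexed by `J`, and these vanish at `G z_k` for
  -- every `k` of the subsequence.
  have hμG : ∀ k, μ (G (z₀ + t (φ k) • d (φ k))) = 0 := fun k => by
    refine tendsto_nhds_unique (tendsto_clm_apply (hm.comp hφ') tendsto_const_nhds)
      (tendsto_const_nhds.congr fun j => ?_)
    rw [Function.comp_apply, ← hcm j, _root_.sum_apply]
    refine (Finset.sum_eq_zero fun i _ => ?_).symm
    by_cases hi : i ∈ J
    · simp [(hact k i).1 hi]
    · simp [hcJ j i hi]
  have hq := tendsto_second_quotient hG (Eventually.of_forall fun j => ht (φ j)) htφ hdφ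
  simp only [hG0, sub_zero] at hq
  -- The projected quotients lie in the cone generated by `-projX (μ ∘ A)` and the active
  -- projections. The generators do not depend on `j`, so closedness puts `θ` in that cone although
  -- the coefficients may be unbounded.
  let b : Option s → StrongDual ℝ X := fun o =>
    o.elim (-projX (μ.comp A)) fun i => if i ∈ J then projX (i.1.comp A) else 0
  have hθmem : θ ∈ {x : StrongDual ℝ X | ∃ c : Option s → ℝ, (∀ i, 0 ≤ c i) ∧
      ∑ i, c i • b i = x} := by
    refine (isClosed_nonneg_combinations b).mem_of_tendsto (hθ.comp hφ')
      (Eventually.of_forall fun j => ?_)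
    have htj := ht (φ j)
    refine ⟨fun o => o.elim (t (φ j))⁻¹ fun i => (t (φ j))⁻¹ * c j i, ?_, ?_⟩
    · rintro (_ | i)
      · exact (inv_pos.2 htj).le
      · exact mul_nonneg (inv_pos.2 htj).le (hc0 j i)
    · rw [Fintype.sum_option]
      have h1 : ∀ i : s, ((t (φ j))⁻¹ * c j i) • (if i ∈ J then projX (i.1.comp A) else 0) =
          (t (φ j))⁻¹ • projX ((c j i • i.1).comp A) := fun i => by
        by_cases hi : i ∈ J
        · rw [if_pos hi, mul_smul]
          rfl
        · rw [if_neg hi, hcJ j i hi, zero_smul]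
          ext
          simp [projX]
      simp only [b, Option.elim, h1, ← Finset.smul_sum]
      have h2 : ∑ i, projX ((c j i • i.1).comp A) = projX ((m (φ j)).comp A) := by
        rw [← hcm j]
        ext x
        simp [projX]
      rw [h2, Function.comp_apply, ← smul_add]
      congr 1
      ext x
      simp [projX]
      ring
  obtain ⟨γ, hγ, hγθ⟩ := hθmem
  rw [Fintype.sum_option] at hγθ
  -- The coefficients representing `θ` define a functional on `E`, and `ω = η ∘ A`. On the critical
  -- cone the `μ`-term vanishes and the others are nonpositive; at `v` all active functionals
  -- vanish.
  set η : StrongDual ℝ E := ∑ i : s, (if i ∈ J then γ (some i) else 0) • i.1 - γ none • μ with hη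
  have hηap : ∀ e, η e = ∑ i : s, (if i ∈ J then γ (some i) else 0) * i.1 e - γ none * μ e :=
    fun e => by simp [hη]
  refine ⟨η.comp A, ⟨⟨hμ, rfl⟩, ?_, hAv, hvan μ hμG, ?_, ?_⟩, ?_⟩
  · rintro μ' ⟨hμ', hcomp⟩
    have h1 := tendsto_clm_apply (tendsto_const_nhds (x := μ' - μ)) hq
    have h2 : (μ' - μ) ((1 / 2 : ℝ) • hess G z₀ v v) ≤ 0 := by
      refine le_of_tendsto' h1 fun j => ?_
      have h3 : μ' (A (d (φ j))) = μ (A (d (φ j))) := DFunLike.congr_fun hcomp (d (φ j))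
      have h4 := hμ' _ (hGK (φ j))
      have h5 : (μ' - μ) ((t (φ j) ^ 2)⁻¹ •
          (G (z₀ + t (φ j) • d (φ j)) - t (φ j) • A (d (φ j)))) =
          (t (φ j) ^ 2)⁻¹ * μ' (G (z₀ + t (φ j) • d (φ j))) := by
        simp only [_root_.sub_apply, map_smul, map_sub, smul_eq_mul, h3, hμG]
        ring
      rw [h5]
      exact mul_nonpos_of_nonneg_of_nonpos (by positivity) h4
    rw [map_smul, _root_.sub_apply, smul_eq_mul] at h2
    linarith
  · intro w hw hμw
    rw [ContinuousLinearMap.comp_apply, hηap, show μ (A w) = 0 from hμw, mul_zero, sub_zero]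
    refine Finset.sum_nonpos fun i _ => mul_nonpos_of_nonneg_of_nonpos ?_ ((hK _).1 hw _ i.2)
    split_ifs
    exacts [hγ _, le_rfl]
  · rw [ContinuousLinearMap.comp_apply, hηap, hvan μ hμG, mul_zero, sub_zero]
    refine Finset.sum_eq_zero fun i _ => ?_
    split_ifs with hi
    · rw [hvan i.1 fun j => (hact j i).1 hi, mul_zero]
    · rw [zero_mul]
  · rw [← hγθ]
    ext x
    simp only [projX, b, Option.elim, ContinuousLinearMap.comp_apply, hηap, _root_.add_apply,
      _root_.smul_apply, _root_.neg_apply, _root_.sum_apply, smul_eq_mul]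
    rw [sub_eq_add_neg, add_comm, mul_neg]
    congr 1
    refine Finset.sum_congr rfl fun i _ => ?_
    split_ifs <;> simp

/-- Bounded multipliers of the slice normals converge to `μ`, and `ζ = μ ∘ ∇G(z₀)` is the lifted
normal. It remains to find an `ω` that solves the second-order system and has the prescribed
projection; only this uses the alternative `hPK`. -/
theorem ParametricSystem.exists_of_mem_tangentCone [FiniteDimensional ℝ P] [FiniteDimensional ℝ X]
    [FiniteDimensional ℝ E] (hs : ParametricSystem G Γ K κ r z₀)
    (hPK : (∀ q : P, ∃ u : X, ∃ e ∈ PointedCone.lineal (K : PointedCone ℝ E),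
      fderiv ℝ G z₀ (q, 0) = fderiv ℝ G z₀ (0, u) + e) ∨ IsPolyhedral (K : Set E))
    {ξ xs : StrongDual ℝ X} {v : P × X}
    (h : (v, xs) ∈ tangentCone (gph fun z : P × X => normalCone (Γ z.1) z.2) (z₀, ξ)) :
    ∃ ζ ∈ normalCone (gph Γ) z₀, projX ζ = ξ ∧ ∃ vs,
      (v, vs) ∈ tangentCone (gph (normalCone (gph Γ))) (z₀, ζ) ∧ xs = projX vs := by
  obtain ⟨t, p, ht, ht0, hp, hmem⟩ := h
  have hd : Tendsto (fun k => (p k).1) atTop (𝓝 v) := (continuous_fst.tendsto _).comp hp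
  have hds : Tendsto (fun k => (p k).2) atTop (𝓝 xs) := (continuous_snd.tendsto _).comp hp
  have hmem' : ∀ k, ξ + t k • (p k).2 ∈
      normalCone (Γ (z₀ + t k • (p k).1).1) (z₀ + t k • (p k).1).2 := hmem
  have hz := tendsto_add_smul_nhds (z₀ := z₀) ht0 hd
  have hξ : Tendsto (fun k => ξ + t k • (p k).2) atTop (𝓝 ξ) := tendsto_add_smul_nhds ht0 hds
  have hev : ∀ᶠ j in atTop, ∃ μ : StrongDual ℝ E, ‖μ‖ ≤ κ * ‖ξ + t j • (p j).2‖ ∧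
      (projX (μ.comp (fderiv ℝ G (z₀ + t j • (p j).1))) = ξ + t j • (p j).2 ∧
        (∀ k ∈ K, μ k ≤ 0) ∧ μ (G (z₀ + t j • (p j).1)) = 0 ∧ G (z₀ + t j • (p j).1) ∈ K) := by
    filter_upwards [hz.eventually hs.eventually_exists_multiplier] with j hj
    obtain ⟨hK, μ, h1, h2, h3, h4⟩ := hj _ (hmem' j)
    exact ⟨μ, h1, h2, h3, h4, hK⟩
  obtain ⟨φ, hφ, m, μ, hm, hprop⟩ := exists_subseq_tendsto_of_bounded (hξ.norm.const_mul κ) hev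
  have hφ' := hφ.tendsto_atTop
  have hμ : ∀ k ∈ K, μ k ≤ 0 := fun k hk =>
    le_of_tendsto' (tendsto_clm_apply hm tendsto_const_nhds) fun j => (hprop j).2.2.1 k hk
  have hdc : Tendsto (fun k => fderiv ℝ G (z₀ + t k • (p k).1)) atTop (𝓝 (fderiv ℝ G z₀)) :=
    ((hs.contDiffAt.of_le (by norm_num)).continuousAt_fderiv one_ne_zero).tendsto.comp hz
  have hμξ : projX (μ.comp (fderiv ℝ G z₀)) = ξ := by
    refine tendsto_nhds_unique ((continuous_projX.tendsto _).comp
      (tendsto_clm_comp hm (hdc.comp hφ'))) ((hξ.comp hφ').congr fun j => ?_)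
    exact (hprop j).2.1.symm
  have hquot := (continuous_projX.tendsto _).comp (tendsto_multiplier_quotient hs.contDiffAt
    (fun k => ht (φ k)) (ht0.comp hφ') (hd.comp hφ') hm)
  have hθ : Tendsto (fun j => (t (φ j))⁻¹ • projX ((m j - μ).comp (fderiv ℝ G z₀))) atTop
      (𝓝 (xs - projX (μ.comp (hess G z₀ v)))) := by
    refine ((hds.comp hφ').sub hquot).congr fun j => ?_
    have h1 := (hprop j).2.1
    simp only [Function.comp_apply, projX_sub, projX_smul] at h1 ⊢
    rw [h1, hμξ, add_sub_cancel_left, smul_smul, inv_mul_cancel₀ (ht _).ne', one_smul]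
    abel
  suffices hsys : ∃ ω, SecondOrderSystem (fderiv ℝ G z₀) (hess G z₀ v v) K
      (μ.comp (fderiv ℝ G z₀)) v μ ω ∧ projX ω = xs - projX (μ.comp (hess G z₀ v)) by
    obtain ⟨ω, hsys, hω⟩ := hsys
    refine ⟨μ.comp (fderiv ℝ G z₀), hs.reducedSystem.eventually_comp_mem_normalCone.self_of_nhds
      (by rw [hs.map_eq_zero]; exact K.zero_mem) μ hμ (by rw [hs.map_eq_zero, map_zero]), hμξ, _,
      hs.reducedSystem.mem_tangentCone_gph hsys, ?_⟩
    rw [projX_add, hω]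
    abel
  rcases hPK with hP | hpoly
  · obtain ⟨ω, hω, hωθ⟩ := exists_tendsto_of_charSubspace (A := fderiv ℝ G z₀)
      (η := fun j => (t (φ j))⁻¹ • (m j - μ)) (fun q => by
        obtain ⟨u, e, he, hAe⟩ := hP q
        refine ⟨u, e, fun j => ?_, hAe⟩
        rw [PointedCone.mem_lineal] at he
        -- Functionals nonpositive on `K` vanish on its lineality space, so the quotients `(m j - μ)
        -- / t j` do as well.
        have h1 : ∀ ν : StrongDual ℝ E, (∀ k ∈ K, ν k ≤ 0) → ν e = 0 := fun ν hν => by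
          have h2 := hν _ he.1
          have h3 := hν _ he.2
          rw [map_neg] at h3
          linarith
        simp [h1 _ hμ, h1 _ (hprop j).2.2.1]) hθ
    obtain ⟨h1, h2, h3, h4, h5, h6⟩ := critical_of_tendsto_multipliers hs.contDiffAt
      hs.map_eq_zero (fun k => ht (φ k)) (ht0.comp hφ') (hd.comp hφ') hm
      (fun j => (hprop j).2.2.1) (fun j => (hprop j).2.2.2.1) (fun j => (hprop j).2.2.2.2) hω
    exact ⟨ω, ⟨⟨h1, rfl⟩, fun μ' hμ' => h6 μ' hμ'.1 hμ'.2, h2, h3, h4, h5⟩, hωθ⟩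
  · obtain ⟨s, hs'⟩ := hpoly.exists_finset_functional
    exact exists_secondOrderSystem_of_polyhedral hs' hs.contDiffAt hs.map_eq_zero
      (fun k => ht (φ k)) (ht0.comp hφ') (hd.comp hφ') hm (fun j => (hprop j).2.2.1)
      (fun j => (hprop j).2.2.2.1) (fun j => (hprop j).2.2.2.2) hθ

end Parametric

/-! ### Transfer between `C` and `K` through the submersion `h`. -/

section Reduction

variable {Y E : Type*} [NormedAddCommGroup Y] [NormedSpace ℝ Y] [NormedAddCommGroup E]
  [NormedSpace ℝ E]

/-- A submersion satisfies a uniform local metric estimate. -/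
theorem exists_preimage_norm_sub_le [CompleteSpace Y] [CompleteSpace E] {h : Y → E} {y₀ : Y}
    (hh : ContDiffAt ℝ 1 h y₀) (hsurj : Function.Surjective (fderiv ℝ h y₀)) (h0 : h y₀ = 0)
    {V : Set Y} (hV : V ∈ 𝓝 y₀) :
    ∃ c r : ℝ, 0 ≤ c ∧ 0 < r ∧ ∀ᶠ y in 𝓝 y₀, ∀ k, ‖k‖ < r →
      ∃ y' ∈ V, h y' = k ∧ ‖y' - y‖ ≤ c * ‖h y - k‖ := by
  have hrange : (fderiv ℝ h y₀).range = ⊤ := LinearMap.range_eq_top.2 hsurj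
  let R := (fderiv ℝ h y₀).nonlinearRightInverseOfSurjective hrange
  have hN : 0 < R.nnnorm := (fderiv ℝ h y₀).nonlinearRightInverseOfSurjective_nnnorm_pos hrange
  have hN' : (0 : ℝ) < R.nnnorm := hN
  -- Half of the admissible approximation constant leaves an openness rate `1 / (2 R.nnnorm)`, so a
  -- ball of radius `2 R.nnnorm ‖h y - k‖` about `y` suffices to reach `k`.
  obtain ⟨s, hs, happ⟩ := (hh.hasStrictFDerivAt one_ne_zero).approximates_deriv_on_nhds
    (c := R.nnnorm⁻¹ / 2) (Or.inr (by positivity))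
  obtain ⟨ε, hε, hball⟩ := Metric.nhds_basis_closedBall.mem_iff.1 (inter_mem hs hV)
  have hcont : Tendsto (fun y => ‖h y‖) (𝓝 y₀) (𝓝 0) := by
    have := hh.continuousAt.tendsto.norm
    rwa [h0, norm_zero] at this
  refine ⟨2 * R.nnnorm, ε / (8 * R.nnnorm), by positivity, by positivity, ?_⟩
  filter_upwards [hcont.eventually_lt_const (by positivity : 0 < ε / (8 * (R.nnnorm : ℝ))),
    Metric.ball_mem_nhds y₀ (half_pos hε)] with y hy hyb k hk
  rw [Metric.mem_ball, dist_eq_norm] at hyb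
  have h1 : ‖h y - k‖ ≤ ε / (4 * R.nnnorm) := by
    refine (norm_sub_le _ _).trans ((add_le_add hy.le hk.le).trans_eq ?_)
    field_simp
    norm_num
  have h2 : 2 * R.nnnorm * ‖h y - k‖ ≤ ε / 2 := by
    have := mul_le_mul_of_nonneg_left h1 (by positivity : 0 ≤ 2 * (R.nnnorm : ℝ))
    refine this.trans_eq ?_
    field_simp
    norm_num
  have hsub : Metric.closedBall y (2 * R.nnnorm * ‖h y - k‖) ⊆ s ∩ V := by
    refine Subset.trans (Metric.closedBall_subset_closedBall' ?_) hball
    rw [dist_eq_norm]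
    linarith
  obtain ⟨y', hy', hk'⟩ := happ.surjOn_closedBall_of_nonlinearRightInverse R
    (ε := 2 * R.nnnorm * ‖h y - k‖) (b := y) (by positivity) (hsub.trans inter_subset_left)
    (show k ∈ _ by
      rw [mem_closedBall_iff_norm', NNReal.coe_div, NNReal.coe_inv, NNReal.coe_ofNat]
      apply le_of_eq
      field_simp
      ring)
  exact ⟨y', (hsub hy').2, hk', by rwa [mem_closedBall_iff_norm] at hy'⟩

theorem hess_clm_comp {F : Type*} [NormedAddCommGroup F] [NormedSpace ℝ F] {f : Y → E} {y : Y}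
    (hf : ContDiffAt ℝ 2 f y) (μ : E →L[ℝ] F) (v : Y) :
    hess (fun y' => μ (f y')) y v = μ.comp (hess f y v) := by
  have h1 : fderiv ℝ (fun y' => μ (f y')) =ᶠ[𝓝 y] fun y' => μ.comp (fderiv ℝ f y') :=
    (hf.eventually (by simp)).mono fun z hz =>
      (μ.hasFDerivAt.comp z (hz.differentiableAt two_ne_zero).hasFDerivAt).fderiv
  have h2 : HasFDerivAt (fun y' => μ.comp (fderiv ℝ f y'))
      ((ContinuousLinearMap.compL ℝ Y E F μ).comp (hess f y)) y :=
    (ContinuousLinearMap.compL ℝ Y E F μ).hasFDerivAt.comp y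
      (hasFDerivAt_fderiv_of_contDiffAt_two hf)
  rw [hess, h1.fderiv_eq, h2.fderiv]
  rfl

theorem hess_comp {Z : Type*} [NormedAddCommGroup Z] [NormedSpace ℝ Z] {g : Z → Y} {h : Y → E}
    {z : Z} (hg : ContDiffAt ℝ 2 g z) (hh : ContDiffAt ℝ 2 h (g z)) (v w : Z) :
    hess (h ∘ g) z v w = fderiv ℝ h (g z) (hess g z v w) +
      hess h (g z) (fderiv ℝ g z v) (fderiv ℝ g z w) := by
  have h1 : fderiv ℝ (h ∘ g) =ᶠ[𝓝 z] fun z' => (fderiv ℝ h (g z')).comp (fderiv ℝ g z') := by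
    filter_upwards [hg.eventually (by simp), hg.continuousAt.eventually (hh.eventually (by simp))]
      with z' h2 h3
    exact fderiv_comp z' (h3.differentiableAt two_ne_zero) (h2.differentiableAt two_ne_zero)
  have h2 : HasFDerivAt (fun z' => fderiv ℝ h (g z')) ((hess h (g z)).comp (fderiv ℝ g z)) z :=
    HasFDerivAt.comp (g := fderiv ℝ h) z (hasFDerivAt_fderiv_of_contDiffAt_two hh)
      (hg.differentiableAt two_ne_zero).hasFDerivAt
  have h3 := h2.clm_comp (hasFDerivAt_fderiv_of_contDiffAt_two hg)
  rw [hess, h1.fderiv_eq, h3.fderiv]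
  simp

variable {C : Set Y} {K : ProperCone ℝ E} {h : Y → E} {y₀ : Y}

theorem IsC2Reduction.contDiffAt (hC : IsC2Reduction C K h y₀) : ContDiffAt ℝ 2 h y₀ := by
  obtain ⟨-, -, -, -, V, hV, hy, hh, -⟩ := hC
  exact hh.contDiffAt (hV.mem_nhds hy)

theorem IsC2Reduction.eventually_mem_iff (hC : IsC2Reduction C K h y₀) :
    ∀ᶠ y in 𝓝 y₀, (y ∈ C ↔ h y ∈ K) := by
  obtain ⟨-, -, -, -, V, hV, hy, -, heq⟩ := hC
  filter_upwards [hV.mem_nhds hy] with y hyV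
  have := Set.ext_iff.1 heq y
  simpa [hyV] using this

theorem IsC2Reduction.exists_subregularAt [CompleteSpace Y] [CompleteSpace E]
    (hC : IsC2Reduction C K h y₀) : ∃ c r : ℝ, 0 ≤ c ∧ 0 < r ∧ SubregularAt h C K c r y₀ := by
  have hcd := hC.contDiffAt
  have hm := hC.eventually_mem_iff
  obtain ⟨-, -, h0, hsurj, -⟩ := hC
  obtain ⟨c, r, hc, hr, hev⟩ := exists_preimage_norm_sub_le (hcd.of_le (by norm_num)) hsurj h0 hm
  refine ⟨c, r, hc, hr, hev.mono fun y hy k hk hkr => ?_⟩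
  obtain ⟨y', h1, h2, h3⟩ := hy k hkr
  exact ⟨y', (h1 : y' ∈ C ↔ h y' ∈ K).2 (h2 ▸ hk), h3⟩

theorem IsC2Reduction.mem_normalCone_iff [CompleteSpace Y] [FiniteDimensional ℝ E]
    (hC : IsC2Reduction C K h y₀) {lam : StrongDual ℝ Y} : lam ∈ normalCone C y₀ ↔
      ∃ μ : StrongDual ℝ E, (∀ k ∈ K, μ k ≤ 0) ∧ adj (fderiv ℝ h y₀) μ = lam := by
  have hcd := hC.contDiffAt
  have hm := hC.eventually_mem_iff
  have : CompleteSpace E := FiniteDimensional.complete ℝ E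
  obtain ⟨c, r, hc, hr, hsub⟩ := hC.exists_subregularAt
  obtain ⟨-, hy₀, h0, -, -⟩ := hC
  have hm' : ∀ᶠ y in 𝓝[C] y₀, h y ∈ K := by
    filter_upwards [self_mem_nhdsWithin, mem_nhdsWithin_of_mem_nhds hm] with y hy hy'
    exact hy'.1 hy
  constructor
  · intro hl
    obtain ⟨μ, -, h1, h2, -⟩ := exists_multiplier_of_mem_normalCone (hcd.of_le (by norm_num))
      hm' (by rwa [h0, norm_zero]) hc hsub hl
    exact ⟨μ, h2, h1⟩
  · rintro ⟨μ, hμ, rfl⟩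
    exact regularNormalCone_subset_normalCone _ _ (comp_mem_regularNormalCone
      (hcd.differentiableAt two_ne_zero).hasFDerivAt hy₀ hm' hμ (by rw [h0, map_zero]))

theorem IsC2Reduction.curvature_adj (hC : IsC2Reduction C K h y₀) (μ : StrongDual ℝ E) (a : Y) :
    curvature h y₀ (adj (fderiv ℝ h y₀) μ) a = μ.comp (hess h y₀ a) := by
  have hcd := hC.contDiffAt
  obtain ⟨-, -, -, hsurj, -⟩ := hC
  rw [curvature, pullback_adj h y₀ hsurj, hess_clm_comp hcd]

variable {Z : Type*} [NormedAddCommGroup Z] [NormedSpace ℝ Z] {g : Z → Y} {z₀ : Z}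

theorem IsC2Reduction.fderiv_comp (hC : IsC2Reduction C K h (g z₀)) (hg : ContDiffAt ℝ 2 g z₀) :
    fderiv ℝ (h ∘ g) z₀ = (fderiv ℝ h (g z₀)).comp (fderiv ℝ g z₀) :=
  _root_.fderiv_comp z₀ (hC.contDiffAt.differentiableAt two_ne_zero)
    (hg.differentiableAt two_ne_zero)

theorem IsC2Reduction.mem_multipliers_iff [CompleteSpace Y] [FiniteDimensional ℝ E]
    (hC : IsC2Reduction C K h (g z₀)) (hg : ContDiffAt ℝ 2 g z₀) {ζ : StrongDual ℝ Z}
    {lam : StrongDual ℝ Y} : lam ∈ multipliers g C z₀ ζ ↔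
      ∃ μ ∈ reducedMultipliers (fderiv ℝ (h ∘ g) z₀) K ζ, adj (fderiv ℝ h (g z₀)) μ = lam := by
  have hfd := hC.fderiv_comp hg
  constructor
  · rintro ⟨h1, h2⟩
    obtain ⟨μ, hμ, rfl⟩ := hC.mem_normalCone_iff.1 h1
    exact ⟨μ, ⟨hμ, by rw [hfd]; exact h2⟩, rfl⟩
  · rintro ⟨μ, ⟨hμ, h2⟩, rfl⟩
    rw [hfd] at h2
    exact ⟨hC.mem_normalCone_iff.2 ⟨μ, hμ, rfl⟩, h2⟩

/-- The second-order chain rule: the curvature of `g` weighted by `λ` and the curvature of `h`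
together make up that of `h ∘ g` weighted by `μ`. -/
theorem IsC2Reduction.hess_add_curvTerm (hC : IsC2Reduction C K h (g z₀))
    (hg : ContDiffAt ℝ 2 g z₀) (μ : StrongDual ℝ E) (v : Z) :
    hess (fun z => adj (fderiv ℝ h (g z₀)) μ (g z)) z₀ v +
      curvTerm g h z₀ (adj (fderiv ℝ h (g z₀)) μ) v = μ.comp (hess (h ∘ g) z₀ v) := by
  rw [hess_clm_comp hg, curvTerm, hC.curvature_adj]
  ext w
  simp [adj, hess_comp hg hC.contDiffAt]

theorem IsC2Reduction.mem_dirMultipliers_iff [CompleteSpace Y] [FiniteDimensional ℝ E]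
    (hC : IsC2Reduction C K h (g z₀)) (hg : ContDiffAt ℝ 2 g z₀) {ζ : StrongDual ℝ Z} {v : Z}
    {lam : StrongDual ℝ Y} : lam ∈ dirMultipliers g C h z₀ ζ v ↔
      ∃ μ ∈ reducedMultipliers (fderiv ℝ (h ∘ g) z₀) K ζ,
        (∀ μ' ∈ reducedMultipliers (fderiv ℝ (h ∘ g) z₀) K ζ,
          μ' (hess (h ∘ g) z₀ v v) ≤ μ (hess (h ∘ g) z₀ v v)) ∧
        adj (fderiv ℝ h (g z₀)) μ = lam := by
  have hobj : ∀ μ : StrongDual ℝ E, adj (fderiv ℝ h (g z₀)) μ (hess g z₀ v v) +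
      curvature h (g z₀) (adj (fderiv ℝ h (g z₀)) μ) (fderiv ℝ g z₀ v) (fderiv ℝ g z₀ v) =
      μ (hess (h ∘ g) z₀ v v) := fun μ => by
    rw [hC.curvature_adj, hess_comp hg hC.contDiffAt, map_add]
    rfl
  constructor
  · rintro ⟨h1, h2⟩
    obtain ⟨μ, hμ, rfl⟩ := (hC.mem_multipliers_iff hg).1 h1
    refine ⟨μ, hμ, fun μ' hμ' => ?_, rfl⟩
    have := h2 ((hC.mem_multipliers_iff hg).2 ⟨μ', hμ', rfl⟩)
    simp only [mem_ofPred_eq] at this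
    rwa [hobj, hobj] at this
  · rintro ⟨μ, hμ, hmax, rfl⟩
    refine ⟨(hC.mem_multipliers_iff hg).2 ⟨μ, hμ, rfl⟩, fun l hl => ?_⟩
    obtain ⟨μ', hμ', rfl⟩ := (hC.mem_multipliers_iff hg).1 hl
    simp only [mem_ofPred_eq]
    rw [hobj, hobj]
    exact hmax μ' hμ'

end Reduction

/-! ### Robinson stability, normals to critical cones and the final assembly. -/

section MainResult

variable {P X Y E : Type*} [NormedAddCommGroup P] [NormedSpace ℝ P] [NormedAddCommGroup X]
  [NormedSpace ℝ X] [NormedAddCommGroup Y] [NormedSpace ℝ Y] [NormedAddCommGroup E]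
  [NormedSpace ℝ E] {g : P × X → Y} {C : Set Y} {K : ProperCone ℝ E} {h : Y → E} {z₀ : P × X}

/-- Robinson stability turns the reduced constraint into a parametric system. -/
theorem RobinsonStable.exists_parametricSystem [CompleteSpace Y] [CompleteSpace E]
    (hRS : RobinsonStable g C z₀) (hg : ContDiffAt ℝ 2 g z₀) (hC : IsC2Reduction C K h (g z₀)) :
    ∃ κ r : ℝ, ParametricSystem (h ∘ g) (Gam g C) K κ r z₀ := by
  have hmem : ∀ᶠ z in 𝓝 z₀, (z.2 ∈ Gam g C z.1 ↔ (h ∘ g) z ∈ K) :=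
    hg.continuousAt.eventually hC.eventually_mem_iff
  obtain ⟨c, r, hc, hr, hsub⟩ := hC.exists_subregularAt
  obtain ⟨κ, W, hW, U, hU, hκ⟩ := hRS
  -- The extra `1` makes the distance bound strict, so that an actual point of `Γ(p)` realizes it; a
  -- zero residual is treated separately, since then `z.2` itself is feasible.
  refine ⟨κ * c + 1, r, hC.contDiffAt.comp z₀ hg, hC.2.2.1, hmem, by positivity, hr, ?_⟩
  filter_upwards [hmem, hg.continuousAt.eventually hsub, prod_mem_nhds hW hU] with z h1 h2 h3 k hk hkr
  obtain ⟨y, hyC, hyn⟩ := h2 k hk hkr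
  rcases (norm_nonneg ((h ∘ g) z - k)).eq_or_lt with h0 | hpos
  · have hz : (h ∘ g) z = k := sub_eq_zero.1 (norm_eq_zero.1 h0.symm)
    exact ⟨z.2, h1.2 (hz ▸ hk), by rw [← h0]; simp⟩
  · have h4 : Metric.infEDist (g z) C ≤ ENNReal.ofReal (c * ‖(h ∘ g) z - k‖) := by
      refine (Metric.infEDist_le_edist_of_mem hyC).trans ?_
      rw [edist_dist, dist_comm, dist_eq_norm]
      exact ENNReal.ofReal_le_ofReal hyn
    have h5 : Metric.infEDist z.2 (Gam g C z.1) <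
        ENNReal.ofReal ((κ * c + 1) * ‖(h ∘ g) z - k‖) := by
      refine (hκ z.1 h3.1 z.2 h3.2).trans_lt ((mul_le_mul_right h4 _).trans_lt ?_)
      rw [← ENNReal.ofReal_coe_nnreal, ← ENNReal.ofReal_mul (NNReal.coe_nonneg κ),
        ENNReal.ofReal_lt_ofReal_iff (by positivity)]
      linarith
    obtain ⟨x, hx, hxd⟩ := Metric.infEDist_lt_iff.1 h5
    refine ⟨x, hx, ?_⟩
    rw [edist_dist, dist_comm, ENNReal.ofReal_lt_ofReal_iff (by positivity), dist_eq_norm] at hxd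
    exact hxd.le

variable {κ r : ℝ}

theorem ReducedSystem.mem_normalCone_criticalCone_iff {Z : Type*} [NormedAddCommGroup Z]
    [NormedSpace ℝ Z] {G : Z → E} {Ω : Set Z} {z₀ : Z} (hs : ReducedSystem G Ω K κ r z₀)
    {ζ ω : StrongDual ℝ Z} {v : Z} : ω ∈ normalCone (criticalCone Ω z₀ ζ) v ↔
      (fderiv ℝ G z₀ v ∈ K ∧ ζ v = 0) ∧
        (∀ w, fderiv ℝ G z₀ w ∈ K → ζ w = 0 → ω w ≤ 0) ∧ ω v = 0 := by
  have he : criticalCone Ω z₀ ζ = {w | fderiv ℝ G z₀ w ∈ K ∧ ζ w = 0} := by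
    rw [criticalCone, hs.tangentCone_eq]
    rfl
  rw [he, mem_normalCone_convexCone]
  · simp only [mem_ofPred_eq, and_imp]
  · rintro w ⟨hw, hw'⟩ u ⟨hu, hu'⟩ a b ha hb -
    refine ⟨?_, ?_⟩
    · rw [map_add, map_smul, map_smul]
      exact K.add_mem (K.smul_mem hw ha) (K.smul_mem hu hb)
    · rw [map_add, map_smul, map_smul, hw', hu']
      simp
  · rintro w ⟨hw, hw'⟩ c hc
    refine ⟨?_, ?_⟩
    · rw [map_smul]
      exact K.smul_mem hw hc
    · rw [map_smul, hw', smul_zero]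

/-- Both normal cones reduce to the polar of the linearized cone `{w | ∇G(z₀)w ∈ K}`, and normality
at `v` adds feasibility and orthogonality. This identifies the index set in the formula for `DΨ`. -/
theorem ReducedSystem.mem_normalCone_tangentCone_iff {Z : Type*} [NormedAddCommGroup Z]
    [NormedSpace ℝ Z] [FiniteDimensional ℝ Z] [FiniteDimensional ℝ E] {G : Z → E} {Ω : Set Z}
    {z₀ : Z} (hs : ReducedSystem G Ω K κ r z₀) {ζ : StrongDual ℝ Z} {v : Z} :
    ζ ∈ normalCone (tangentCone Ω z₀) v ↔
      ζ ∈ normalCone Ω z₀ ∧ fderiv ℝ G z₀ v ∈ K ∧ ζ v = 0 := by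
  have hpol : ζ ∈ normalCone Ω z₀ ↔ ∀ w, fderiv ℝ G z₀ w ∈ K → ζ w ≤ 0 := by
    constructor
    · intro hζ w hw
      obtain ⟨-, μ, -, rfl, hμ, -⟩ := hs.eventually_exists_multiplier.self_of_nhds ζ hζ
      exact hμ _ hw
    · intro h1
      refine regularNormalCone_subset_normalCone _ _
        (mem_regularNormalCone_of_polar_tangentCone hs.mem ?_)
      rw [hs.tangentCone_eq]
      exact h1
  rw [hpol, hs.tangentCone_eq, mem_normalCone_convexCone]
  · simp only [mem_ofPred_eq]
    tauto
  · intro w hw u hu a b ha hb _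
    rw [mem_ofPred_eq, map_add, map_smul, map_smul]
    exact K.add_mem (K.smul_mem hw ha) (K.smul_mem hu hb)
  · intro w hw c hc
    rw [mem_ofPred_eq, map_smul]
    exact K.smul_mem hw hc

/-- Tangents to the graph of the normal cone mapping in terms of the original data. -/
theorem mem_tangentCone_gph_normalCone_iff {Z : Type*} [NormedAddCommGroup Z] [NormedSpace ℝ Z]
    [FiniteDimensional ℝ Z] [CompleteSpace Y] [FiniteDimensional ℝ E] {g : Z → Y} {Ω : Set Z}
    {z₀ : Z} (hg : ContDiffAt ℝ 2 g z₀) (hC : IsC2Reduction C K h (g z₀))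
    (hs : ReducedSystem (h ∘ g) Ω K κ r z₀) {ζ vs : StrongDual ℝ Z} {v : Z} :
    (v, vs) ∈ tangentCone (gph (normalCone Ω)) (z₀, ζ) ↔
      ∃ lam ∈ dirMultipliers g C h z₀ ζ v, ∃ ω ∈ normalCone (criticalCone Ω z₀ ζ) v,
        vs = hess (fun z => lam (g z)) z₀ v + curvTerm g h z₀ lam v + ω := by
  rw [hs.mem_tangentCone_gph_iff]
  constructor
  · rintro ⟨μ, ω, hsys, rfl⟩
    refine ⟨_, (hC.mem_dirMultipliers_iff hg).2 ⟨μ, hsys.mem, hsys.isMax, rfl⟩, ω,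
      hs.mem_normalCone_criticalCone_iff.2 ⟨⟨hsys.map_mem, hsys.critical⟩, hsys.polar, hsys.orth⟩,
      ?_⟩
    rw [hC.hess_add_curvTerm hg]
  · rintro ⟨lam, hlam, ω, hω, rfl⟩
    obtain ⟨μ, h1, h2, rfl⟩ := (hC.mem_dirMultipliers_iff hg).1 hlam
    obtain ⟨⟨h3, h4⟩, h5, h6⟩ := hs.mem_normalCone_criticalCone_iff.1 hω
    exact ⟨μ, ω, ⟨h1, h2, h3, h4, h5, h6⟩, by rw [hC.hess_add_curvTerm hg]⟩

end MainResult

end VarAnalysis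

open VarAnalysis in
theorem mainTheorem11
    {P X Y E : Type*}
    [NormedAddCommGroup P] [InnerProductSpace ℝ P] [FiniteDimensional ℝ P]
    [NormedAddCommGroup X] [InnerProductSpace ℝ X] [FiniteDimensional ℝ X]
    [NormedAddCommGroup Y] [InnerProductSpace ℝ Y] [FiniteDimensional ℝ Y]
    [NormedAddCommGroup E] [InnerProductSpace ℝ E] [FiniteDimensional ℝ E]
    (g : P × X → Y) (C : Set Y) (K : ProperCone ℝ E) (h : Y → E)
    (pbar : P) (xbar : X) (xsbar : StrongDual ℝ X)
    (hg : ContDiffAt ℝ 2 g (pbar, xbar))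
    (hC : IsC2Reduction C K h (g (pbar, xbar)))
    (hx : xsbar ∈ Psi g C (pbar, xbar))
    (hRS : RobinsonStable g C (pbar, xbar))
    (hPK : charSubspace g h K (pbar, xbar) = Set.univ ∨ IsPolyhedral (K : Set E)) :
    -- the tangent cone to the graph of the normal cone mapping
    tangentCone (gph (Psi g C)) ((pbar, xbar), xsbar) =
      (⋃ zs ∈ normalCone (gph (Gam g C)) (pbar, xbar) ∩ projX ⁻¹' {xsbar},
        {w : (P × X) × StrongDual ℝ X | ∃ vs : StrongDual ℝ (P × X),
          (w.1, vs) ∈ tangentCone (gph (normalCone (gph (Gam g C)))) ((pbar, xbar), zs) ∧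
          w.2 = projX vs}) ∧
    -- the graphical derivative of the normal cone mapping
    (∀ v : P × X, graphicalDeriv (Psi g C) (pbar, xbar) xsbar v =
      ⋃ zs ∈ normalCone (tangentCone (gph (Gam g C)) (pbar, xbar)) v ∩ projX ⁻¹' {xsbar},
        projX '' graphicalDeriv (normalCone (gph (Gam g C))) (pbar, xbar) zs v) ∧
    -- the objects on the right-hand sides
    (∀ zs ∈ normalCone (gph (Gam g C)) (pbar, xbar),
      tangentCone (gph (normalCone (gph (Gam g C)))) ((pbar, xbar), zs) =
        {w : (P × X) × StrongDual ℝ (P × X) |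
          ∃ lam ∈ dirMultipliers g C h (pbar, xbar) zs w.1,
          ∃ ws ∈ normalCone (criticalCone (gph (Gam g C)) (pbar, xbar) zs) w.1,
            w.2 = hess (fun z => lam (g z)) (pbar, xbar) w.1
              + curvTerm g h (pbar, xbar) lam w.1 + ws} ∧
      ∀ v : P × X, graphicalDeriv (normalCone (gph (Gam g C))) (pbar, xbar) zs v =
        {vs | ∃ lam ∈ dirMultipliers g C h (pbar, xbar) zs v,
          ∃ ws ∈ normalCone (criticalCone (gph (Gam g C)) (pbar, xbar) zs) v,
            vs = hess (fun z => lam (g z)) (pbar, xbar) v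
              + curvTerm g h (pbar, xbar) lam v + ws}) := by
  set z₀ : P × X := (pbar, xbar) with hz₀
  obtain ⟨κ, r, hs⟩ := hRS.exists_parametricSystem hg hC
  have hred := hs.reducedSystem
  have hcond : (∀ q : P, ∃ u : X, ∃ e ∈ PointedCone.lineal (K : PointedCone ℝ E),
      fderiv ℝ (h ∘ g) z₀ (q, 0) = fderiv ℝ (h ∘ g) z₀ (0, u) + e) ∨
      IsPolyhedral (K : Set E) :=
    hPK.imp_left fun hP q => Set.eq_univ_iff_forall.1 hP q
  have hfst : ∀ (v : P × X) (xs : StrongDual ℝ X),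
      (v, xs) ∈ tangentCone (gph (Psi g C)) (z₀, xsbar) ↔
        ∃ zs ∈ normalCone (gph (Gam g C)) z₀, projX zs = xsbar ∧ ∃ vs,
          (v, vs) ∈ tangentCone (gph (normalCone (gph (Gam g C)))) (z₀, zs) ∧ xs = projX vs := by
    intro v xs
    constructor
    · exact hs.exists_of_mem_tangentCone hcond
    · rintro ⟨zs, -, rfl, vs, hvs, rfl⟩
      exact hs.projX_mem_tangentCone hvs
  refine ⟨?_, fun v => ?_, fun zs _ => ⟨?_, fun v => ?_⟩⟩
  · ext ⟨v, xs⟩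
    simp only [hfst, mem_iUnion, mem_inter_iff, mem_preimage, mem_singleton_iff, mem_ofPred_eq,
      exists_prop, and_assoc]
  · ext xs
    simp only [graphicalDeriv, mem_ofPred_eq, hfst, mem_iUnion, mem_inter_iff, mem_preimage,
      mem_singleton_iff, mem_image, exists_prop, hred.mem_normalCone_tangentCone_iff, and_assoc]
    constructor
    · rintro ⟨zs, h1, h2, vs, h3, rfl⟩
      -- Restricting the union to normals of the tangent cone at `v` loses nothing: any tangent over
      -- `v` already makes `v` critical for `zs`.
      obtain ⟨μ, ω, hsys, -⟩ := hred.mem_tangentCone_gph_iff.1 h3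
      exact ⟨zs, h1, hsys.map_mem, hsys.critical, h2, vs, h3, rfl⟩
    · rintro ⟨zs, h1, -, -, h2, vs, h3, rfl⟩
      exact ⟨zs, h1, h2, vs, h3, rfl⟩
  · ext ⟨v, vs⟩
    exact mem_tangentCone_gph_normalCone_iff hg hC hred
  · ext vs
    exact mem_tangentCone_gph_normalCone_iff hg hC hred
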